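/- Let $T_0>0$. Let $\mathbf u_0\in H^{1/2}(\mathbb R^3)$ be a vector field with $\operatorname{div}\mathbf u_0=0$ and let $\theta_0\in\dot H^{-1/2}(\mathbb R^3)$. Consider the Boussinesq system $\partial_t\mathbf u-\Delta\mathbf u+(\mathbf u\cdot\nabla)\mathbf u+\nabla P=\theta\mathbf e_3$, $\ \partial_t\theta-\Delta\theta+\mathbf u\cdot\nabla\theta=0$, $\ \operatorname{div}\mathbf u=0$, with $\mathbf u(0)=\mathbf u_0$, $\theta(0)=\theta_0$, on $[0,T_0]\times\mathbb R^3$. A (mild) solution of it is a couple $(\mathbf u,\theta)$ that satisfies, for almost every $t\in[0,T_0]$, in the sense of tempered distributions, $$\mathbf u(t)=e^{t\Delta}\mathbf u_0-\int_0^te^{(t-\tau)\Delta}\mathbb P\big((\mathbf u\cdot\nabla)\mathbf u\big)(\tau)\,d\tau+\int_0^te^{(t-\tau)\Delta}\mathbb P(\theta\mathbf e_3)(\tau)\,d\tau,$$ $$\theta(t)=e^{t\Delta}\theta_0-\int_0^te^{(t-\tau)\Delta}(\mathbf u\cdot\nabla\theta)(\tau)\,d\tau,$$ where $\mathbb P$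 is the Leray projector, $(\mathbf u\cdot\nabla)\mathbf u=\operatorname{div}(\mathbf u\otimes\mathbf u)$ and $\mathbf u\cdot\nabla\theta=\operatorname{div}(\theta\mathbf u)$. Let $(\mathbf u_1,\theta_1)$ and $(\mathbf u_2,\theta_2)$ be two such solutions with the same initial data $(\mathbf u_0,\theta_0)$, and suppose that for $i=1,2$ $$\mathbf u_i\in L^\infty([0,T_0],H^{1/2}(\mathbb R^3))\cap L^2([0,T_0],\dot H^{3/2}(\mathbb R^3)),$$ $$\theta_i\in L^\infty([0,T_0],\dot H^{-1/2}(\mathbb R^3))\cap L^2([0,T_0],\dot H^{1/2}\cap\dot W^{1,3}(\mathbb R^3)).$$ Then $(\mathbf u_1,\theta_1)=(\mathbf u_2,\theta_2)$, that is, $\mathbf u_1(t)=\mathbf u_2(t)$ and $\theta_1(t)=\theta_2(t)$ for almost every $t\in[0,T_0]$. -/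

import Mathlib

open MeasureTheory Set FourierTransform LineDeriv
open scoped SchwartzMap ENNReal

noncomputable section

namespace Boussinesq

/-- The space `ℝ³`. -/
abbrev R3 : Type := EuclideanSpace ℝ (Fin 3)

/-- Tempered distributions on `ℝ³`. They are complex-valued; real-valued fields are a special
case. -/
abbrev Distr : Type := 𝓢'(R3, ℂ)

/-- The `j`-th vector of the canonical basis of `ℝ³`. -/
def basisVec (j : Fin 3) : R3 := EuclideanSpace.single j 1

/-! ### Function spaces on `ℝ³` -/

/-- The tempered distribution `T` is (integration against) the function `f`. Such an `f` is
locally integrable, and it is determined by `T` up to null sets. -/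
def Represents (T : Distr) (f : R3 → ℂ) : Prop :=
  ∀ φ : 𝓢(R3, ℂ), Integrable (fun x => φ x * f x) ∧ T φ = ∫ x, φ x * f x

/-- The `Lᵖ` norm of a distribution, equal to `∞` if it is not an `Lᵖ` function. -/
def lebesgueNorm (p : ℝ≥0∞) (T : Distr) : ℝ≥0∞ :=
  ⨅ (f : R3 → ℂ) (_ : Represents T f), eLpNorm f p volume

/-- The norm of the (inhomogeneous) Sobolev space `Hˢ = W^{s,2}`: the `L²` norm of the Bessel
potential of order `s`. It is equal to `∞` outside this space. -/
def sobolevNorm (s : ℝ) (T : Distr) : ℝ≥0∞ :=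
  lebesgueNorm 2 (TemperedDistribution.besselPotential R3 ℂ s T)

/-- The norm of the homogeneous Sobolev space of order `s`, which consists of the tempered
distributions whose Fourier transform is a locally integrable function `g` with
`∫ |ξ|^{2s} |g(ξ)|² dξ < ∞`. It is equal to `∞` outside this space. -/
def homSobolevNorm (s : ℝ) (T : Distr) : ℝ≥0∞ :=
  ⨅ (g : R3 → ℂ) (_ : Represents (𝓕 T) g),
    eLpNorm (fun ξ : R3 => ((‖ξ‖ ^ s : ℝ) : ℂ) * g ξ) 2 volume

/-- The norm of the homogeneous Sobolev space `W^{1,p}`: the `Lᵖ` norm of the distributional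
gradient. It is equal to `∞` outside this space. -/
def homW1Norm (p : ℝ≥0∞) (T : Distr) : ℝ≥0∞ :=
  ∑ j : Fin 3, lebesgueNorm p (∂_{basisVec j} T)

/-- The time-dependent distribution `v` belongs to `Lᵖ([0, T₀], X)`, where `X` is the space of
distributions with finite norm `N`: it is measurable in time, and its norm is in `Lᵖ(0, T₀)`. -/
def MemLpTime (p : ℝ≥0∞) (T₀ : ℝ) (N : Distr → ℝ≥0∞) (v : ℝ → Distr) : Prop :=
  (∀ φ : 𝓢(R3, ℂ), AEMeasurable (fun t => v t φ) (volume.restrict (Icc 0 T₀))) ∧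
  AEMeasurable (fun t => N (v t)) (volume.restrict (Icc 0 T₀)) ∧
  eLpNorm (fun t => N (v t)) p (volume.restrict (Icc 0 T₀)) < ∞

/-! ### The operators in the system -/

/-- The divergence of a vector field, in the sense of distributions. -/
def divergence (F : Fin 3 → Distr) : Distr := ∑ j : Fin 3, ∂_{basisVec j} (F j)

open Classical in
/-- The product of two distributions that are functions `f` and `g` such that `f g` is again a
tempered distribution (in particular, of any two `L²` functions); `0` in all other cases. -/
def mul (S T : Distr) : Distr :=
  if h : ∃ R : Distr, ∃ f g : R3 → ℂ,
      Represents S f ∧ Represents T g ∧ Represents R (fun x => f x * g x)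
  then h.choose else 0

/-- The advection term `u · ∇f = div (f u)` of a divergence-free vector field `u`. -/
def advection (u : Fin 3 → Distr) (f : Distr) : Distr := divergence (fun j => mul (u j) f)

/-- The heat semigroup `exp (t Δ)`, `t ≥ 0`: the Fourier multiplier with symbol
`exp (-t |2πξ|²)`. -/
def heat (t : ℝ) : Distr →L[ℂ] Distr :=
  TemperedDistribution.fourierMultiplierCLM ℂ
    (fun ξ : R3 => ((Real.exp (-t * (2 * Real.pi * ‖ξ‖) ^ 2) : ℝ) : ℂ))

open Classical in
/-- The `i`-th component of the Leray projection of a vector field `F` whose Fourier transform is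
a function `G`: the distribution whose Fourier transform is
`∑ₖ (δᵢₖ - ξᵢ ξₖ / |ξ|²) Gₖ(ξ)`. It is `0` if there is no such distribution. -/
def leray (F : Fin 3 → Distr) (i : Fin 3) : Distr :=
  if h : ∃ R : Distr, ∃ G : Fin 3 → R3 → ℂ, (∀ k, Represents (𝓕 (F k)) (G k)) ∧
      Represents (𝓕 R) (fun ξ => ∑ k : Fin 3,
        (((if i = k then 1 else 0) - ξ i * ξ k / ‖ξ‖ ^ 2 : ℝ) : ℂ) * G k ξ)
  then h.choose else 0

/-- The buoyancy force `θ e₃`. -/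
def buoyancy (T : Distr) : Fin 3 → Distr := fun k => if k = 2 then T else 0

/-! ### Mild solutions -/

/-- `(u, θ)` is a mild solution on `[0, T₀]` of the Boussinesq system with initial data
`(u₀, θ₀)`: for almost every `t`,
`u(t) = exp(tΔ) u₀ - ∫₀ᵗ exp((t-τ)Δ) ℙ((u·∇)u)(τ) dτ + ∫₀ᵗ exp((t-τ)Δ) ℙ(θ e₃)(τ) dτ`,
`θ(t) = exp(tΔ) θ₀ - ∫₀ᵗ exp((t-τ)Δ) (u·∇θ)(τ) dτ`,
where the integrals of distributions are taken in the weak sense, against test functions. -/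
structure IsMildSolution (T₀ : ℝ) (u₀ : Fin 3 → Distr) (θ₀ : Distr)
    (u : ℝ → Fin 3 → Distr) (θ : ℝ → Distr) : Prop where
  velocity : ∀ᵐ t ∂(volume.restrict (Icc 0 T₀)), ∀ (i : Fin 3) (φ : 𝓢(R3, ℂ)),
    IntervalIntegrable
      (fun τ => heat (t - τ) (leray (fun k => advection (u τ) (u τ k)) i) φ) volume 0 t ∧
    IntervalIntegrable (fun τ => heat (t - τ) (leray (buoyancy (θ τ)) i) φ) volume 0 t ∧
    u t i φ = heat t (u₀ i) φ
      - (∫ τ in 0..t, heat (t - τ) (leray (fun k => advection (u τ) (u τ k)) i) φ)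
      + ∫ τ in 0..t, heat (t - τ) (leray (buoyancy (θ τ)) i) φ
  temperature : ∀ᵐ t ∂(volume.restrict (Icc 0 T₀)), ∀ φ : 𝓢(R3, ℂ),
    IntervalIntegrable (fun τ => heat (t - τ) (advection (u τ) (θ τ)) φ) volume 0 t ∧
    θ t φ = heat t θ₀ φ - ∫ τ in 0..t, heat (t - τ) (advection (u τ) (θ τ)) φ

/-- The regularity class of the velocity: `u ∈ L^∞([0,T₀], H^{1/2}) ∩ L²([0,T₀], Ḣ^{3/2})`. -/
def VelocityClass (T₀ : ℝ) (u : ℝ → Fin 3 → Distr) : Prop :=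
  ∀ i : Fin 3, MemLpTime ∞ T₀ (sobolevNorm (1 / 2)) (fun t => u t i) ∧
    MemLpTime 2 T₀ (homSobolevNorm (3 / 2)) (fun t => u t i)

/-- The regularity class of the temperature:
`θ ∈ L^∞([0,T₀], Ḣ^{-1/2}) ∩ L²([0,T₀], Ḣ^{1/2} ∩ Ẇ^{1,3})`. -/
def TemperatureClass (T₀ : ℝ) (θ : ℝ → Distr) : Prop :=
  MemLpTime ∞ T₀ (homSobolevNorm (-1 / 2)) θ ∧
  MemLpTime 2 T₀ (homSobolevNorm (1 / 2)) θ ∧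
  MemLpTime 2 T₀ (homW1Norm 3) θ

end Boussinesq

end

noncomputable section

namespace Boussinesq

open Filter Topology

/-! ### Distributions represented by functions -/

namespace Represents

variable {S T : Distr} {f g : R3 → ℂ}

/-! The argument is an energy estimate at the critical regularity, carried out entirely on the
Fourier side. Put `w = u₁ - u₂` and `η = θ₁ - θ₂`. Subtracting the two mild formulas removes the
free evolution, so `w` and `η` are Duhamel integrals of the differences of the forcing terms.
Throughout, `energy s` is a squared weighted norm: the index `s` corresponds to `Ḣ^{s/2}`.

Parabolic smoothing: for zero initial data, Cauchy–Schwarz in time against the heat kernel, at each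
fixed frequency, gives an `L^∞ Ḣ^{s/2}` bound and an `L² Ḣ^{s/2+1}` bound by the `L² Ḣ^{s/2-1}` norm
of the force (`energy_duhamel_le`, `lintegral_energy_duhamel_le`). It is used with `s = 1` for `w`
and `s = -1` for `η`.

Product laws: `Ḣ¹ · Ḣ¹ ⊂ Ḣ^{1/2}` and `L² · Ḣ¹ ⊂ Ḣ^{-1/2}` in dimension three
(`exists_energy_one_econv_le`, `exists_energy_econv_le`). After the divergence they place the
velocity advection in `Ḣ^{-1/2}` and the temperature advection in `Ḣ^{-3/2}`. Buoyancy contributes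
the `Ḣ^{-1/2}` norm of `η` itself.

Closing: let `E` be the squared norm of `(w, η)` in `Ḣ^{1/2} × Ḣ^{-1/2}`, `D` that in `Ḣ^{3/2} ×
Ḣ^{1/2}`, `P` that in `Ḣ¹ × L²`, and let `a` collect the squared `Ḣ¹` norms of the `uᵢ` and the
squared `L²` norm of `θ₁`. The estimates give `E(t) + ∫₀ᵗ D ≤ K ∫₀ᵗ (P a + E)`. Interpolation gives
`P² ≤ 16 E D` and makes `a²` integrable in time. Young's inequality absorbs `D`, and a Gronwall
lemma with the integrable weight `16 K² a² + 2 K` forces `E = 0`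
(`ae_eq_zero_of_energy_inequality`).

Two preliminaries make this rigorous for distributions. The Fourier transform of a product of `L²`
functions is a convolution, so the forcing terms have explicit symbols (`represents_fourier_mul`).
The Fourier transforms of the solutions have jointly measurable representatives, so Tonelli applies
in time and frequency (`exists_measurable_represents`). -/

theorem locallyIntegrable (h : Represents T f) : LocallyIntegrable f := by
  rw [locallyIntegrable_iff]
  intro K hK
  obtain ⟨R, hR, hKR⟩ := hK.isBounded.exists_pos_norm_le
  -- Testing against a bump equal to `1` on `K` turns integrability of `φ f` into integrability of
  -- `f` on `K`.
  let b : ContDiffBump (0 : R3) := ⟨R, R + 1, hR, by linarith⟩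
  have hc : HasCompactSupport (fun x : R3 => ((b x : ℝ) : ℂ)) :=
    b.hasCompactSupport.comp_left (g := fun x : ℝ => (x : ℂ)) (by simp)
  have hd : ContDiff ℝ (⊤ : ℕ∞) (fun x : R3 => ((b x : ℝ) : ℂ)) :=
    Complex.ofRealCLM.contDiff.comp b.contDiff
  have := (h (hc.toSchwartzMap hd)).1.integrableOn (s := K)
  refine this.congr_fun (fun x hx => ?_) hK.measurableSet
  have : b x = 1 := b.one_of_mem_closedBall (by simpa using hKR x hx)
  simp [this]

theorem aestronglyMeasurable (h : Represents T f) : AEStronglyMeasurable f volume :=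
  h.locallyIntegrable.aestronglyMeasurable

/-- The du Bois-Reymond lemma. Because of it, the infima over representatives in the definitions of
the norms run over a single class modulo null sets. -/
theorem ae_eq (hf : Represents T f) (hg : Represents T g) : f =ᵐ[volume] g := by
  refine ae_eq_of_integral_contDiff_smul_eq hf.locallyIntegrable hg.locallyIntegrable ?_
  intro φ hφ hc
  have hc' : HasCompactSupport (fun x : R3 => ((φ x : ℝ) : ℂ)) :=
    hc.comp_left (g := fun x : ℝ => (x : ℂ)) (by simp)
  have hd : ContDiff ℝ (⊤ : ℕ∞) (fun x : R3 => ((φ x : ℝ) : ℂ)) :=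
    Complex.ofRealCLM.contDiff.comp hφ
  have := (hf (hc'.toSchwartzMap hd)).2.symm.trans (hg (hc'.toSchwartzMap hd)).2
  simpa using this

theorem congr_ae (hf : Represents T f) (h : f =ᵐ[volume] g) : Represents T g := by
  intro φ
  have h' : (fun x => φ x * f x) =ᵐ[volume] fun x => φ x * g x := by
    filter_upwards [h] with x hx
    rw [hx]
  exact ⟨(hf φ).1.congr h', (hf φ).2.trans (integral_congr_ae h')⟩

theorem distr_eq (hS : Represents S f) (hT : Represents T f) : S = T := by
  ext φ
  rw [(hS φ).2, (hT φ).2]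

theorem zero : Represents 0 (fun _ => 0) := fun φ => by simp

theorem add (hS : Represents S f) (hT : Represents T g) :
    Represents (S + T) (fun x => f x + g x) := by
  intro φ
  have : (fun x => φ x * (f x + g x)) = fun x => φ x * f x + φ x * g x := by
    ext x; ring
  rw [this]
  refine ⟨(hS φ).1.add (hT φ).1, ?_⟩
  rw [integral_add (hS φ).1 (hT φ).1, ← (hS φ).2, ← (hT φ).2]
  rfl

theorem sum {ι : Type*} (s : Finset ι) {S : ι → Distr} {f : ι → R3 → ℂ}
    (h : ∀ i ∈ s, Represents (S i) (f i)) :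
    Represents (∑ i ∈ s, S i) (fun x => ∑ i ∈ s, f i x) := by
  classical
  induction s using Finset.induction_on with
  | empty => simpa using zero
  | insert a s ha ih =>
    simp only [Finset.sum_insert ha]
    exact (h a (by simp)).add (ih fun i hi => h i (by simp [hi]))

theorem const_smul (c : ℂ) (hT : Represents T f) : Represents (c • T) (fun x => c * f x) := by
  intro φ
  have : (fun x => φ x * (c * f x)) = fun x => c * (φ x * f x) := by
    ext x; ring
  rw [this, integral_const_mul, ← (hT φ).2]
  exact ⟨(hT φ).1.const_mul c, rfl⟩

theorem smulLeft {a : R3 → ℂ} (ha : a.HasTemperateGrowth) (hT : Represents T f) :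
    Represents (TemperedDistribution.smulLeftCLM ℂ a T) (fun x => a x * f x) := by
  intro φ
  have := hT (SchwartzMap.smulLeftCLM ℂ a φ)
  have e : (fun x => SchwartzMap.smulLeftCLM ℂ a φ x * f x) = fun x => φ x * (a x * f x) := by
    ext x
    rw [SchwartzMap.smulLeftCLM_apply_apply ha]
    simp only [smul_eq_mul]
    ring
  rw [e] at this
  exact this

theorem lineDeriv (h : Represents (𝓕 T) f) (j : Fin 3) :
    Represents (𝓕 (∂_{basisVec j} T)) (fun ξ => (2 * Real.pi * Complex.I) * ((ξ j : ℝ) * f ξ)) := by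
  rw [TemperedDistribution.fourier_lineDerivOp_eq]
  refine const_smul _ ?_
  have hg : (fun x : R3 => ((inner ℝ x (basisVec j) : ℝ) : ℂ)).HasTemperateGrowth := by
    fun_prop
  have := h.smulLeft hg
  simpa [basisVec, EuclideanSpace.inner_single_right] using this

end Represents

/-! ### Lebesgue functions as distributions, and Plancherel's theorem -/

theorem represents_toLp {p : ℝ≥0∞} [Fact (1 ≤ p)] {f : R3 → ℂ} (hf : MemLp f p volume) :
    Represents (hf.toLp f : Distr) f := by
  intro φ
  have hp := ENNReal.HolderConjugate.inv_one_sub_inv' (Fact.out : 1 ≤ p)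
  refine ⟨?_, ?_⟩
  · have := MemLp.integrable_mul (p := p) (q := (1 - p⁻¹)⁻¹) hf (φ.memLp _ volume)
    refine this.congr (ae_of_all _ fun x => ?_)
    simp [mul_comm]
  · rw [Lp.toTemperedDistribution_apply]
    refine integral_congr_ae ?_
    filter_upwards [hf.coeFn_toLp] with x hx
    simp [hx]

theorem Represents.fourier {T : Distr} {f : R3 → ℂ} (h : Represents T f) (hf : MemLp f 2 volume) :
    ∃ g : R3 → ℂ, MemLp g 2 volume ∧ Represents (𝓕 T) g ∧
      eLpNorm g 2 volume = eLpNorm f 2 volume := by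
  let F : Lp ℂ 2 (volume : Measure R3) := hf.toLp f
  have hT : T = (F : Distr) := h.distr_eq (represents_toLp hf)
  refine ⟨(𝓕 F : Lp ℂ 2 (volume : Measure R3)), Lp.memLp _, ?_, ?_⟩
  · rw [hT, Lp.fourier_toTemperedDistribution_eq]
    have := represents_toLp (Lp.memLp (𝓕 F : Lp ℂ 2 (volume : Measure R3)))
    rwa [Lp.toLp_coeFn] at this
  · have h1 : ‖(𝓕 F : Lp ℂ 2 (volume : Measure R3))‖ₑ = ‖F‖ₑ := by
      rw [← ofReal_norm, ← ofReal_norm, Lp.norm_fourier_eq]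
    rw [← Lp.enorm_def, h1, Lp.enorm_def]
    exact eLpNorm_congr_ae hf.coeFn_toLp

theorem Represents.fourierInv {T : Distr} {g : R3 → ℂ} (h : Represents (𝓕 T) g)
    (hg : MemLp g 2 volume) : ∃ f : R3 → ℂ, MemLp f 2 volume ∧ Represents T f := by
  let G : Lp ℂ 2 (volume : Measure R3) := hg.toLp g
  have hT : T = 𝓕⁻ (G : Distr) := by
    rw [← h.distr_eq (represents_toLp hg), fourierInv_fourier_eq]
  refine ⟨(𝓕⁻ G : Lp ℂ 2 (volume : Measure R3)), Lp.memLp _, ?_⟩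
  rw [hT, Lp.fourierInv_toTemperedDistribution_eq]
  have := represents_toLp (Lp.memLp (𝓕⁻ G : Lp ℂ 2 (volume : Measure R3)))
  rwa [Lp.toLp_coeFn] at this

/-! ### Sobolev norms of distributions whose Fourier transform is a function -/

theorem homSobolevNorm_eq {T : Distr} {g : R3 → ℂ} (s : ℝ) (h : Represents (𝓕 T) g) :
    homSobolevNorm s T = eLpNorm (fun ξ : R3 => ((‖ξ‖ ^ s : ℝ) : ℂ) * g ξ) 2 volume := by
  refine le_antisymm (iInf₂_le g h) (le_iInf₂ fun g' h' => ?_)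
  refine (eLpNorm_congr_ae ?_).le
  filter_upwards [h.ae_eq h'] with x hx
  rw [hx]

theorem exists_represents_of_homSobolevNorm_lt_top {T : Distr} {s : ℝ}
    (h : homSobolevNorm s T < ∞) : ∃ g, Represents (𝓕 T) g := by
  simp only [homSobolevNorm, iInf_lt_iff] at h
  obtain ⟨g, hg, -⟩ := h
  exact ⟨g, hg⟩

theorem lebesgueNorm_eq {T : Distr} {f : R3 → ℂ} (p : ℝ≥0∞) (h : Represents T f) :
    lebesgueNorm p T = eLpNorm f p volume :=
  le_antisymm (iInf₂_le f h) (le_iInf₂ fun _ h' => (eLpNorm_congr_ae (h.ae_eq h')).le)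

theorem hasTemperateGrowth_besselWeight (r : ℝ) :
    (fun ξ : R3 => (((1 + ‖ξ‖ ^ 2) ^ r : ℝ) : ℂ)).HasTemperateGrowth := by
  fun_prop

/-- The Bessel potential of `T` is an `L²` function, so by Plancherel its Fourier transform is one
too. Multiplying by the inverse weight, which has temperate growth, recovers `𝓕 T` as a function. -/
theorem exists_represents_of_sobolevNorm_lt_top {T : Distr} {s : ℝ} (h : sobolevNorm s T < ∞) :
    ∃ g, Represents (𝓕 T) g ∧
      sobolevNorm s T = eLpNorm (fun ξ : R3 => (((1 + ‖ξ‖ ^ 2) ^ (s / 2) : ℝ) : ℂ) * g ξ) 2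
        volume := by
  have h0 := h
  simp only [sobolevNorm, lebesgueNorm, iInf_lt_iff] at h
  obtain ⟨f, hf, hlt⟩ := h
  obtain ⟨k, -, hk, hkf⟩ := hf.fourier ⟨hf.aestronglyMeasurable, hlt⟩
  rw [TemperedDistribution.fourier_besselPotential_eq_smulLeftCLM_fourier_apply] at hk
  have hpos : ∀ ξ : R3, 0 < 1 + ‖ξ‖ ^ 2 := fun ξ => by positivity
  have h1 := hk.smulLeft (hasTemperateGrowth_besselWeight (-(s / 2)))
  rw [TemperedDistribution.smulLeftCLM_smulLeftCLM_apply (hasTemperateGrowth_besselWeight _)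
    (hasTemperateGrowth_besselWeight _)] at h1
  have e : ((fun ξ : R3 => (((1 + ‖ξ‖ ^ 2) ^ (s / 2) : ℝ) : ℂ)) *
      fun ξ : R3 => (((1 + ‖ξ‖ ^ 2) ^ (-(s / 2)) : ℝ) : ℂ)) = fun _ => 1 := by
    ext ξ
    simp only [Pi.mul_apply]
    rw [← Complex.ofReal_mul, ← Real.rpow_add (hpos ξ)]
    simp
  rw [e, TemperedDistribution.smulLeftCLM_const, one_smul] at h1
  refine ⟨_, h1, ?_⟩
  rw [sobolevNorm, lebesgueNorm_eq 2 hf, ← hkf]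
  congr 1
  ext ξ
  rw [← mul_assoc, ← Complex.ofReal_mul, ← Real.rpow_add (hpos ξ)]
  simp

theorem sobolevNorm_eq {T : Distr} {g : R3 → ℂ} {s : ℝ} (hg : Represents (𝓕 T) g)
    (h : sobolevNorm s T < ∞) : sobolevNorm s T =
      eLpNorm (fun ξ : R3 => (((1 + ‖ξ‖ ^ 2) ^ (s / 2) : ℝ) : ℂ) * g ξ) 2 volume := by
  obtain ⟨g', hg', e⟩ := exists_represents_of_sobolevNorm_lt_top h
  rw [e]
  refine eLpNorm_congr_ae ?_
  filter_upwards [hg.ae_eq hg'] with x hx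
  rw [hx]

/-! ### Convolutions and the Fourier transform of a product -/

/-- The convolution of two functions on `ℝ³`. -/
def conv (f g : R3 → ℂ) (ξ : R3) : ℂ := ∫ η, f (ξ - η) * g η

theorem memLp_comp_sub_left {f : R3 → ℂ} {p : ℝ≥0∞} (hf : MemLp f p volume) (ξ : R3) :
    MemLp (fun η => f (ξ - η)) p volume :=
  hf.comp_measurePreserving (Measure.measurePreserving_sub_left volume ξ)

theorem eLpNorm_comp_sub_left {f : R3 → ℂ} {p : ℝ≥0∞} (hf : MemLp f p volume) (ξ : R3) :
    eLpNorm (fun η => f (ξ - η)) p volume = eLpNorm f p volume :=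
  eLpNorm_comp_measurePreserving hf.aestronglyMeasurable
    (Measure.measurePreserving_sub_left volume ξ)

theorem integrable_conv {f g : R3 → ℂ} (hf : MemLp f 2 volume) (hg : MemLp g 2 volume) (ξ : R3) :
    Integrable (fun η => f (ξ - η) * g η) :=
  (memLp_comp_sub_left hf ξ).integrable_mul hg

theorem lintegral_enorm_conv_le {f g : R3 → ℂ} (hf : MemLp f 2 volume) (hg : MemLp g 2 volume)
    (ξ : R3) : ∫⁻ η, ‖f (ξ - η) * g η‖ₑ ≤ eLpNorm f 2 volume * eLpNorm g 2 volume := by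
  have := eLpNorm_smul_le_mul_eLpNorm (p := 2) (q := 2) (r := 1) hg.aestronglyMeasurable
    (memLp_comp_sub_left hf ξ).aestronglyMeasurable
  rw [eLpNorm_comp_sub_left hf ξ, eLpNorm_one_eq_lintegral_enorm] at this
  simpa using this

theorem norm_conv_le {f g : R3 → ℂ} (hf : MemLp f 2 volume) (hg : MemLp g 2 volume) (ξ : R3) :
    ‖conv f g ξ‖ ≤ (eLpNorm f 2 volume).toReal * (eLpNorm g 2 volume).toReal := by
  rw [← ENNReal.toReal_mul, ← toReal_enorm]
  exact ENNReal.toReal_mono (ENNReal.mul_ne_top hf.eLpNorm_ne_top hg.eLpNorm_ne_top)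
    ((enorm_integral_le_lintegral_enorm _).trans (lintegral_enorm_conv_le hf hg ξ))

theorem integral_norm_conv_le {f g : R3 → ℂ} (hf : MemLp f 2 volume) (hg : MemLp g 2 volume)
    (ξ : R3) :
    ∫ η, ‖f (ξ - η) * g η‖ ≤ (eLpNorm f 2 volume).toReal * (eLpNorm g 2 volume).toReal := by
  rw [← ENNReal.toReal_mul, integral_norm_eq_lintegral_enorm
    (integrable_conv hf hg ξ).aestronglyMeasurable]
  exact ENNReal.toReal_mono (ENNReal.mul_ne_top hf.eLpNorm_ne_top hg.eLpNorm_ne_top)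
    (lintegral_enorm_conv_le hf hg ξ)

/-- The equality holds at every point, since each value is an integral and reflected translations
preserve null sets. -/
theorem conv_congr {f f' g g' : R3 → ℂ} (hf : f =ᵐ[volume] f') (hg : g =ᵐ[volume] g') :
    conv f g = conv f' g' := by
  ext ξ
  refine integral_congr_ae ?_
  filter_upwards [(Measure.measurePreserving_sub_left (volume : Measure R3)
    ξ).quasiMeasurePreserving.ae hf, hg] with η h1 h2
  rw [h1, h2]

theorem conv_sub_left {f f' g : R3 → ℂ} (hf : MemLp f 2 volume) (hf' : MemLp f' 2 volume)
    (hg : MemLp g 2 volume) (ξ : R3) :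
    conv (fun ξ => f ξ - f' ξ) g ξ = conv f g ξ - conv f' g ξ := by
  rw [conv, conv, conv, ← integral_sub (integrable_conv hf hg ξ) (integrable_conv hf' hg ξ)]
  simp only [sub_mul]

theorem conv_sub_right {f g g' : R3 → ℂ} (hf : MemLp f 2 volume) (hg : MemLp g 2 volume)
    (hg' : MemLp g' 2 volume) (ξ : R3) :
    conv f (fun ξ => g ξ - g' ξ) ξ = conv f g ξ - conv f g' ξ := by
  rw [conv, conv, conv, ← integral_sub (integrable_conv hf hg ξ) (integrable_conv hf hg' ξ)]
  simp only [mul_sub]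

theorem measurable_conv {α : Type*} [MeasurableSpace α] {f g : α → R3 → ℂ}
    (hf : Measurable (Function.uncurry f)) (hg : Measurable (Function.uncurry g)) :
    Measurable (fun p : α × R3 => conv (f p.1) (g p.1) p.2) := by
  have h : Measurable (fun q : (α × R3) × R3 => f q.1.1 (q.1.2 - q.2) * g q.1.1 q.2) := by
    have h1 : Measurable (fun q : (α × R3) × R3 => (q.1.1, q.1.2 - q.2)) := by fun_prop
    have h2 : Measurable (fun q : (α × R3) × R3 => (q.1.1, q.2)) := by fun_prop
    exact (hf.comp h1).mul (hg.comp h2)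
  exact (StronglyMeasurable.integral_prod_right' (f := fun q : (α × R3) × R3 =>
    f q.1.1 (q.1.2 - q.2) * g q.1.1 q.2) h.stronglyMeasurable).measurable

theorem measurable_conv_const {f g : R3 → ℂ} (hf : Measurable f) (hg : Measurable g) :
    Measurable (conv f g) := by
  have := measurable_conv (α := Unit) (f := fun _ => f) (g := fun _ => g)
    (hf.comp measurable_snd) (hg.comp measurable_snd)
  exact this.comp (measurable_const.prodMk measurable_id : Measurable fun ξ : R3 => ((), ξ))

theorem aestronglyMeasurable_conv {f g : R3 → ℂ} (hf : MemLp f 2 volume)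
    (hg : MemLp g 2 volume) : AEStronglyMeasurable (conv f g) volume := by
  obtain ⟨f', hf', e⟩ := hf.aestronglyMeasurable
  obtain ⟨g', hg', e'⟩ := hg.aestronglyMeasurable
  rw [conv_congr e e']
  exact (measurable_conv_const hf'.measurable hg'.measurable).aestronglyMeasurable

theorem memLp_top_conv {f g : R3 → ℂ} (hf : MemLp f 2 volume) (hg : MemLp g 2 volume) :
    MemLp (conv f g) ∞ volume :=
  memLp_top_of_bound (aestronglyMeasurable_conv hf hg) _ (ae_of_all _ (norm_conv_le hf hg))

theorem integrable_prod_conv {f g φ : R3 → ℂ} (hf : MemLp f 2 volume) (hg : MemLp g 2 volume)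
    (hφ : Integrable φ) :
    Integrable (fun p : R3 × R3 => φ p.1 * (f (p.1 - p.2) * g p.2)) (volume.prod volume) := by
  have hm : AEStronglyMeasurable (fun p : R3 × R3 => φ p.1 * (f (p.1 - p.2) * g p.2))
      (volume.prod volume) := by
    refine hφ.aestronglyMeasurable.comp_fst.mul (AEStronglyMeasurable.mul ?_
      hg.aestronglyMeasurable.comp_snd)
    exact hf.aestronglyMeasurable.comp_quasiMeasurePreserving
      (quasiMeasurePreserving_sub_of_right_invariant volume volume)
  rw [integrable_prod_iff hm]
  refine ⟨ae_of_all _ fun ξ => (integrable_conv hf hg ξ).const_mul (φ ξ), ?_⟩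
  refine Integrable.mono' (hφ.norm.mul_const
    ((eLpNorm f 2 volume).toReal * (eLpNorm g 2 volume).toReal)) hm.norm.integral_prod_right'
    (ae_of_all _ fun ξ => ?_)
  simp only [norm_mul (φ ξ), integral_const_mul]
  rw [norm_mul, norm_norm, Real.norm_of_nonneg (integral_nonneg fun _ => norm_nonneg _)]
  gcongr
  exact integral_norm_conv_le hf hg ξ

/-- The Fourier transform of the product of a Schwartz function and an `L²` function. -/
theorem integral_fourier_mul_schwartz {T : Distr} {g' g : R3 → ℂ} (hT : Represents T g')
    (hTF : Represents (𝓕 T) g) (hg : MemLp g 2 volume) (φ s : 𝓢(R3, ℂ)) :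
    ∫ x, (𝓕 φ) x * (s x * g' x) = ∫ ξ, φ ξ * conv (𝓕 s : 𝓢(R3, ℂ)) g ξ := by
  set B := ContinuousLinearMap.mul ℂ ℂ with hB
  -- The test function `(𝓕 φ) s` is itself a Fourier transform, so pairing it with `T` amounts to
  -- pairing `φ * 𝓕⁻ s` with `𝓕 T`, which is `g`. Unfolding the convolution and applying Fubini
  -- gives the claim.
  have h1 : 𝓕 (SchwartzMap.convolution B φ (𝓕⁻ s)) = SchwartzMap.pairing B (𝓕 φ) s := by
    rw [SchwartzMap.fourier_convolution, fourier_fourierInv_eq]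
  have h2 := (hT (SchwartzMap.pairing B (𝓕 φ) s)).2
  rw [← h1, ← TemperedDistribution.fourier_apply,
    (hTF _).2] at h2
  have h3 : ∀ ζ, SchwartzMap.convolution B φ (𝓕⁻ s) ζ * g ζ =
      ∫ t, φ t * ((𝓕 s) (t - ζ) * g ζ) := by
    intro ζ
    rw [SchwartzMap.convolution_apply, MeasureTheory.convolution, ← integral_mul_const]
    refine integral_congr_ae (ae_of_all _ fun t => ?_)
    have : (𝓕⁻ s) (ζ - t) = (𝓕 s) (t - ζ) := by
      rw [SchwartzMap.fourierInv_apply_eq]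
      simp
    simp only [hB, ContinuousLinearMap.mul_apply', this]
    ring
  have h4 : ∀ x, (SchwartzMap.pairing B (𝓕 φ) s) x * g' x = (𝓕 φ) x * (s x * g' x) := by
    intro x
    rw [SchwartzMap.pairing_apply_apply, hB, ContinuousLinearMap.mul_apply', mul_assoc]
  have hprod := integrable_prod_conv (SchwartzMap.memLp (𝓕 s) 2 volume) hg φ.integrable
  simp only [h1, h4] at h2
  rw [← h2]
  simp only [h3]
  set k : 𝓢(R3, ℂ) := 𝓕 s
  have hswap : Integrable (Function.uncurry fun ζ t => φ t * (k (t - ζ) * g ζ))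
      (volume.prod volume) := hprod.swap
  rw [integral_integral_swap hswap]
  exact integral_congr_ae (ae_of_all _ fun t => integral_const_mul _ _)

/-- At each `ξ` the convolution is a bounded linear functional of `F`, and Cauchy–Schwarz bounds it
uniformly in `ξ`. Dominated convergence then applies. This allows the product formula to be extended
from Schwartz functions to `L²` by density. -/
theorem continuous_integral_mul_conv {g : R3 → ℂ} (hg : MemLp g 2 volume) {φ : R3 → ℂ}
    (hφ : Integrable φ) :
    Continuous fun F : Lp ℂ 2 (volume : Measure R3) => ∫ ξ, φ ξ * conv F g ξ := by
  rw [continuous_iff_continuousAt]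
  intro F₀
  refine continuousAt_of_dominated (bound := fun ξ => ‖φ ξ‖ * ((‖F₀‖ + 1) *
    (eLpNorm g 2 volume).toReal)) ?_ ?_ (hφ.norm.mul_const _) (ae_of_all _ fun ξ => ?_)
  · exact Eventually.of_forall fun F =>
      hφ.aestronglyMeasurable.mul (aestronglyMeasurable_conv (Lp.memLp F) hg)
  · filter_upwards [Metric.ball_mem_nhds F₀ one_pos] with F hF
    refine ae_of_all _ fun ξ => ?_
    rw [norm_mul]
    have hn : ‖F‖ ≤ ‖F₀‖ + 1 := by
      have := norm_le_norm_add_norm_sub' F F₀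
      rw [mem_ball_iff_norm] at hF
      linarith
    have := norm_conv_le (Lp.memLp F) hg ξ
    rw [← Lp.norm_def] at this
    gcongr
    exact this.trans (by gcongr)
  · refine ContinuousAt.mul continuousAt_const (Continuous.continuousAt ?_)
    have hG := memLp_comp_sub_left hg ξ
    let L := ((ContinuousLinearMap.mul ℂ ℂ).lpPairing volume 2 2).flip (hG.toLp _)
    have : (fun F : Lp ℂ 2 (volume : Measure R3) => conv F g ξ) = L := by
      ext F
      simp only [L, ContinuousLinearMap.flip_apply, ContinuousLinearMap.lpPairing_eq_integral]
      rw [conv, ← integral_sub_left_eq_self _ volume ξ]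
      refine integral_congr_ae ?_
      filter_upwards [hG.coeFn_toLp] with η hη
      simp [hη]
    rw [this]
    exact L.continuous

/-- The Fourier transform of the product of two `L²` functions. -/
theorem integral_fourier_mul {T : Distr} {g' g : R3 → ℂ} (hT : Represents T g')
    (hTF : Represents (𝓕 T) g) (hg' : MemLp g' 2 volume) (hg : MemLp g 2 volume) (φ : 𝓢(R3, ℂ))
    (F : Lp ℂ 2 (volume : Measure R3)) :
    ∫ x, (𝓕 φ) x * (F x * g' x) =
      ∫ ξ, φ ξ * conv (𝓕 F : Lp ℂ 2 (volume : Measure R3)) g ξ := by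
  have hK : MemLp (fun x => (𝓕 φ) x * g' x) 2 volume :=
    MemLp.mul (p := ∞) (q := 2) hg' ((𝓕 φ).memLp_top volume)
  -- Both sides are continuous in `F` for the `L²` norm, so only Schwartz functions have to be
  -- checked.
  refine DenseRange.induction_on (p := fun F : Lp ℂ 2 (volume : Measure R3) =>
    ∫ x, (𝓕 φ) x * (F x * g' x) =
      ∫ ξ, φ ξ * conv (𝓕 F : Lp ℂ 2 (volume : Measure R3)) g ξ)
    (SchwartzMap.denseRange_toLpCLM (p := 2) ENNReal.ofNat_ne_top) F ?_ ?_
  · refine isClosed_eq ?_ ?_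
    · let L := ((ContinuousLinearMap.mul ℂ ℂ).lpPairing volume 2 2).flip (hK.toLp _)
      have : (fun F : Lp ℂ 2 (volume : Measure R3) => ∫ x, (𝓕 φ) x * (F x * g' x)) = L := by
        ext F
        simp only [L, ContinuousLinearMap.flip_apply, ContinuousLinearMap.lpPairing_eq_integral]
        refine integral_congr_ae ?_
        filter_upwards [hK.coeFn_toLp] with η hη
        simp only [hη, ContinuousLinearMap.mul_apply']
        ring
      rw [this]
      exact L.continuous
    · exact (continuous_integral_mul_conv hg φ.integrable).comp
        (fourierCLM ℂ (Lp ℂ 2 (volume : Measure R3))).continuous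
  · intro s
    simp only [SchwartzMap.toLpCLM_apply, SchwartzMap.toLp_fourier_eq]
    rw [conv_congr (SchwartzMap.coeFn_toLp (𝓕 s : 𝓢(R3, ℂ)) 2 volume) (EventuallyEq.refl _ g),
      ← integral_fourier_mul_schwartz hT hTF hg]
    refine integral_congr_ae ?_
    filter_upwards [SchwartzMap.coeFn_toLp s 2 volume] with x hx
    rw [hx]

/-- The product of two `L²` functions is in `L¹`, so the first case of the definition applies.
Whatever distribution is chosen there, uniqueness of representatives identifies it. -/
theorem represents_mul {S T : Distr} {f g : R3 → ℂ} (hS : Represents S f) (hT : Represents T g)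
    (hf : MemLp f 2 volume) (hg : MemLp g 2 volume) :
    Represents (mul S T) (fun x => f x * g x) := by
  have hfg : MemLp (fun x => f x * g x) 1 volume := MemLp.mul (p := 2) (q := 2) hg hf
  have h : ∃ R : Distr, ∃ f g : R3 → ℂ,
      Represents S f ∧ Represents T g ∧ Represents R (fun x => f x * g x) :=
    ⟨_, f, g, hS, hT, represents_toLp hfg⟩
  rw [mul, dif_pos h]
  obtain ⟨f', g', hf', hg', hR⟩ := h.choose_spec
  refine hR.congr_ae ?_
  filter_upwards [hf'.ae_eq hS, hg'.ae_eq hT] with x h1 h2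
  rw [h1, h2]

theorem represents_fourier_mul {S T : Distr} {f g : R3 → ℂ} (hS : Represents (𝓕 S) f)
    (hT : Represents (𝓕 T) g) (hf : MemLp f 2 volume) (hg : MemLp g 2 volume) :
    Represents (𝓕 (mul S T)) (conv f g) := by
  obtain ⟨f', hf', hSf⟩ := hS.fourierInv hf
  obtain ⟨g', hg', hTg⟩ := hT.fourierInv hg
  have hm := represents_mul hSf hTg hf' hg'
  let F : Lp ℂ 2 (volume : Measure R3) := hf'.toLp f'
  have hF : S = (F : Distr) := hSf.distr_eq (represents_toLp hf')
  have hFF : f =ᵐ[volume] (𝓕 F : Lp ℂ 2 (volume : Measure R3)) := by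
    refine hS.ae_eq ?_
    rw [hF, Lp.fourier_toTemperedDistribution_eq]
    have := represents_toLp (Lp.memLp (𝓕 F : Lp ℂ 2 (volume : Measure R3)))
    rwa [Lp.toLp_coeFn] at this
  intro φ
  refine ⟨?_, ?_⟩
  · exact φ.integrable.mul_of_top_left (memLp_top_conv hf hg)
  · rw [TemperedDistribution.fourier_apply, (hm _).2,
      conv_congr hFF (EventuallyEq.refl _ g), ← integral_fourier_mul hTg hT hg' hg]
    refine integral_congr_ae ?_
    filter_upwards [hf'.coeFn_toLp] with x hx
    simp only [F, hx]

/-! ### The operators in the system on the Fourier side -/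

/-- The Fourier transform of `u · ∇f = div (f u)`, where `V` and `g` are those of `u` and `f`. -/
def advSymbol (V : Fin 3 → R3 → ℂ) (g : R3 → ℂ) (ξ : R3) : ℂ :=
  ∑ j : Fin 3, (2 * Real.pi * Complex.I) * ((ξ j : ℝ) * conv (V j) g ξ)

/-- The symbol of the Leray projector. -/
def leraySymbol (i k : Fin 3) (ξ : R3) : ℝ := (if i = k then 1 else 0) - ξ i * ξ k / ‖ξ‖ ^ 2

/-- The symbol of the heat semigroup. -/
def heatSymbol (t : ℝ) (ξ : R3) : ℝ := Real.exp (-t * (2 * Real.pi * ‖ξ‖) ^ 2)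

theorem represents_fourier_advection {u : Fin 3 → Distr} {f : Distr} {V : Fin 3 → R3 → ℂ}
    {g : R3 → ℂ} (hu : ∀ j, Represents (𝓕 (u j)) (V j)) (hV : ∀ j, MemLp (V j) 2 volume)
    (hf : Represents (𝓕 f) g) (hg : MemLp g 2 volume) :
    Represents (𝓕 (advection u f)) (advSymbol V g) := by
  have : 𝓕 (advection u f) = ∑ j : Fin 3, 𝓕 (∂_{basisVec j} (mul (u j) f)) := by
    rw [advection, divergence]
    exact map_sum (fourierCLM ℂ Distr) _ _
  rw [this]
  exact Represents.sum _ fun j _ => (represents_fourier_mul (hu j) hf (hV j) hg).lineDeriv j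

theorem measurable_leraySymbol (i k : Fin 3) : Measurable (leraySymbol i k) := by
  unfold leraySymbol
  fun_prop

theorem abs_coord_le_norm (ξ : R3) (i : Fin 3) : |ξ i| ≤ ‖ξ‖ := by
  simpa using PiLp.norm_apply_le ξ i

theorem abs_leraySymbol_le (i k : Fin 3) (ξ : R3) : |leraySymbol i k ξ| ≤ 2 := by
  have h1 : |(if i = k then 1 else 0 : ℝ)| ≤ 1 := by split_ifs <;> simp
  have h2 : |ξ i * ξ k / ‖ξ‖ ^ 2| ≤ 1 := by
    rw [abs_div, abs_mul, abs_of_nonneg (by positivity : 0 ≤ ‖ξ‖ ^ 2), sq]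
    exact div_le_one_of_le₀ (mul_le_mul (abs_coord_le_norm ξ i) (abs_coord_le_norm ξ k)
      (abs_nonneg _) (norm_nonneg _)) (by positivity)
  exact (abs_sub _ _).trans (by linarith)

theorem memLp_sum_leraySymbol_mul {p : ℝ≥0∞} {C : Fin 3 → R3 → ℂ}
    (hC : ∀ k, MemLp (C k) p volume) (i : Fin 3) :
    MemLp (fun ξ => ∑ k : Fin 3, (leraySymbol i k ξ : ℂ) * C k ξ) p volume := by
  refine memLp_finsetSum _ fun k _ => ?_
  refine MemLp.of_le_mul (c := 2) (hC k) ?_ (ae_of_all _ fun ξ => ?_)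
  · exact (Complex.measurable_ofReal.comp (measurable_leraySymbol i k)).aestronglyMeasurable.mul
      (hC k).aestronglyMeasurable
  · rw [norm_mul, Complex.norm_real, Real.norm_eq_abs]
    gcongr
    exact abs_leraySymbol_le i k ξ

/-- `R` only witnesses that the projected symbol is the Fourier transform of some tempered
distribution. The choice made in `leray` then has the same symbol, since the functions representing
`𝓕 (F k)` are unique up to null sets. -/
theorem represents_fourier_leray {F : Fin 3 → Distr} {G : Fin 3 → R3 → ℂ} {i : Fin 3} {R : Distr}
    (hF : ∀ k, Represents (𝓕 (F k)) (G k))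
    (hR : Represents (𝓕 R) (fun ξ => ∑ k : Fin 3, (leraySymbol i k ξ : ℂ) * G k ξ)) :
    Represents (𝓕 (leray F i)) (fun ξ => ∑ k : Fin 3, (leraySymbol i k ξ : ℂ) * G k ξ) := by
  have h : ∃ R : Distr, ∃ G : Fin 3 → R3 → ℂ, (∀ k, Represents (𝓕 (F k)) (G k)) ∧
      Represents (𝓕 R) (fun ξ => ∑ k : Fin 3,
        (((if i = k then 1 else 0) - ξ i * ξ k / ‖ξ‖ ^ 2 : ℝ) : ℂ) * G k ξ) :=
    ⟨R, G, hF, hR⟩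
  rw [leray, dif_pos h]
  obtain ⟨G', hG', hR'⟩ := h.choose_spec
  refine hR'.congr_ae ?_
  have := ae_all_iff.2 fun k => (hG' k).ae_eq (hF k)
  filter_upwards [this] with ξ hξ
  exact Finset.sum_congr rfl fun k _ => by rw [hξ k]; rfl

theorem represents_fourier_leray_buoyancy {T : Distr} {g : R3 → ℂ} (hT : Represents (𝓕 T) g)
    (hg : MemLp g 2 volume) (i : Fin 3) :
    Represents (𝓕 (leray (buoyancy T) i)) (fun ξ => (leraySymbol i 2 ξ : ℂ) * g ξ) := by
  let G : Fin 3 → R3 → ℂ := fun k => if k = 2 then g else fun _ => 0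
  have hF : ∀ k, Represents (𝓕 (buoyancy T k)) (G k) := by
    intro k
    by_cases hk : k = 2
    · simpa [buoyancy, G, hk] using hT
    · have : 𝓕 (0 : Distr) = 0 := (fourierCLM ℂ Distr).map_zero
      simpa [buoyancy, G, hk, this] using Represents.zero
  have hG : ∀ k, MemLp (G k) 2 volume := by
    intro k
    by_cases hk : k = 2
    · simpa [G, hk] using hg
    · simp [G, hk]
  let M : Distr := ((memLp_sum_leraySymbol_mul hG i).toLp _ : Distr)
  have hm : Represents (𝓕 (𝓕⁻ M)) (fun ξ => ∑ k : Fin 3, (leraySymbol i k ξ : ℂ) * G k ξ) := by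
    simpa only [M, fourier_fourierInv_eq] using represents_toLp (memLp_sum_leraySymbol_mul hG i)
  have := represents_fourier_leray hF hm
  simpa [G, Fin.sum_univ_three] using this

/-- The Leray symbol is not smooth at the origin and the advection symbol carries a growing factor
`ξⱼ`. So the projection is applied first to the convolutions, which are bounded and remain so, and
the divergence is taken afterwards, Fourier multipliers being interchangeable. -/
theorem represents_fourier_leray_advection {u : Fin 3 → Distr} {V : Fin 3 → R3 → ℂ}
    (hu : ∀ j, Represents (𝓕 (u j)) (V j)) (hV : ∀ j, MemLp (V j) 2 volume) (i : Fin 3) :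
    Represents (𝓕 (leray (fun k => advection u (u k)) i))
      (fun ξ => ∑ k : Fin 3, (leraySymbol i k ξ : ℂ) * advSymbol V (V k) ξ) := by
  have hM : ∀ j, MemLp (fun ξ => ∑ k : Fin 3, (leraySymbol i k ξ : ℂ) * conv (V j) (V k) ξ)
      ∞ volume := fun j => memLp_sum_leraySymbol_mul (fun k => memLp_top_conv (hV j) (hV k)) i
  let M : Fin 3 → Distr := fun j => 𝓕⁻ ((hM j).toLp _ : Distr)
  have hMr : ∀ j, Represents (𝓕 (M j))
      (fun ξ => ∑ k : Fin 3, (leraySymbol i k ξ : ℂ) * conv (V j) (V k) ξ) := by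
    intro j
    simpa only [M, fourier_fourierInv_eq] using represents_toLp (hM j)
  refine represents_fourier_leray (R := ∑ j, ∂_{basisVec j} (M j))
    (fun k => represents_fourier_advection hu hV (hu k) (hV k)) ?_
  have e : 𝓕 (∑ j, ∂_{basisVec j} (M j)) = ∑ j : Fin 3, 𝓕 (∂_{basisVec j} (M j)) :=
    map_sum (fourierCLM ℂ Distr) _ _
  rw [e]
  refine (Represents.sum Finset.univ fun j _ => (hMr j).lineDeriv j).congr_ae
    (ae_of_all _ fun ξ => ?_)
  simp only [advSymbol, Finset.mul_sum]
  rw [Finset.sum_comm]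
  refine Finset.sum_congr rfl fun k _ => Finset.sum_congr rfl fun j _ => ?_
  ring

theorem hasTemperateGrowth_heatSymbol {t : ℝ} (ht : 0 ≤ t) :
    (fun ξ : R3 => (heatSymbol t ξ : ℂ)).HasTemperateGrowth := by
  have hf : (fun ξ : R3 => -t * (2 * Real.pi * ‖ξ‖) ^ 2).HasTemperateGrowth := by
    have : (fun ξ : R3 => -t * (2 * Real.pi * ‖ξ‖) ^ 2) =
        fun ξ : R3 => (-t * (2 * Real.pi) ^ 2) * ‖ξ‖ ^ 2 := by
      ext ξ; ring
    rw [this]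
    fun_prop
  -- The exponential does not have temperate growth on the whole line. On this open neighbourhood of
  -- the range all its derivatives are bounded by `e`.
  have hr : Set.range (fun ξ : R3 => -t * (2 * Real.pi * ‖ξ‖) ^ 2) ⊆ Iio 1 := by
    rintro _ ⟨ξ, rfl⟩
    have : 0 ≤ t * (2 * Real.pi * ‖ξ‖) ^ 2 := by positivity
    simp only [mem_Iio]
    linarith
  have hexp : (Real.exp ∘ fun ξ : R3 => -t * (2 * Real.pi * ‖ξ‖) ^ 2).HasTemperateGrowth := by
    refine Function.HasTemperateGrowth.comp' hr isOpen_Iio.uniqueDiffOn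
      Real.contDiff_exp.contDiffOn (fun N => ⟨0, Real.exp 1, by positivity, fun n _ x hx => ?_⟩) hf
    rw [iteratedFDerivWithin_of_isOpen n isOpen_Iio hx, norm_iteratedFDeriv_eq_norm_iteratedDeriv,
      iteratedDeriv_eq_iterate, Real.iter_deriv_exp, Real.norm_of_nonneg (Real.exp_nonneg _)]
    simpa using (le_of_lt hx : x ≤ 1)
  exact Function.HasTemperateGrowth.comp (g := Complex.ofReal)
    Function.Complex.hasTemperateGrowth_ofReal hexp

theorem represents_fourier_heat {T : Distr} {g : R3 → ℂ} (hT : Represents (𝓕 T) g) {t : ℝ}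
    (ht : 0 ≤ t) : Represents (𝓕 (heat t T)) (fun ξ => (heatSymbol t ξ : ℂ) * g ξ) := by
  have : 𝓕 (heat t T) =
      TemperedDistribution.smulLeftCLM ℂ (fun ξ : R3 => (heatSymbol t ξ : ℂ)) (𝓕 T) := by
    rw [heat, TemperedDistribution.fourierMultiplierCLM_apply, fourier_fourierInv_eq]
    rfl
  rw [this]
  exact hT.smulLeft (hasTemperateGrowth_heatSymbol ht)

/-! ### Joint measurability of functions representing time-dependent distributions -/

/-- A sequence of bump functions that shrinks to the origin. -/
def mollifier (n : ℕ) : ContDiffBump (0 : R3) :=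
  ⟨1 / ((n : ℝ) + 1), 2 * (1 / ((n : ℝ) + 1)), by positivity, by
    have : 0 < 1 / ((n : ℝ) + 1) := by positivity
    linarith⟩

theorem hasCompactSupport_mollifier (n : ℕ) (q : R3) :
    HasCompactSupport (fun x : R3 => (((mollifier n).normed volume (q - x) : ℝ) : ℂ)) := by
  have h := (mollifier n).hasCompactSupport_normed (μ := (volume : Measure R3))
  have h1 : HasCompactSupport (fun x : R3 => (mollifier n).normed volume (q - x)) :=
    h.comp_homeomorph (Homeomorph.subLeft q)
  exact h1.comp_left (g := fun x : ℝ => (x : ℂ)) (by simp)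

theorem contDiff_mollifier (n : ℕ) (q : R3) :
    ContDiff ℝ (⊤ : ℕ∞) (fun x : R3 => (((mollifier n).normed volume (q - x) : ℝ) : ℂ)) :=
  Complex.ofRealCLM.contDiff.comp
    ((mollifier n).contDiff_normed.comp (contDiff_const.sub contDiff_id))

/-- The mollifier centred at `q`, as a test function. -/
def mollifierTest (n : ℕ) (q : R3) : 𝓢(R3, ℂ) :=
  (hasCompactSupport_mollifier n q).toSchwartzMap (contDiff_mollifier n q)

theorem Represents.apply_mollifierTest {T : Distr} {f : R3 → ℂ} (h : Represents T f) (n : ℕ)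
    (q : R3) : T (mollifierTest n q) = convolution ((mollifier n).normed volume) f
      (ContinuousLinearMap.lsmul ℝ ℝ) volume q := by
  rw [(h _).2, convolution_lsmul_swap]
  exact integral_congr_ae (ae_of_all _ fun x => (Complex.real_smul).symm)

theorem Represents.continuous_apply_mollifierTest {T : Distr} {f : R3 → ℂ} (h : Represents T f)
    (n : ℕ) : Continuous fun q => T (mollifierTest n q) := by
  simp only [h.apply_mollifierTest]
  exact HasCompactSupport.continuous_convolution_left _ (mollifier n).hasCompactSupport_normed
    (mollifier n).continuous_normed h.locallyIntegrable

theorem Represents.ae_tendsto_mollifierTest {T : Distr} {f : R3 → ℂ} (h : Represents T f) :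
    ∀ᵐ ξ, Tendsto (fun n => T (mollifierTest n ξ)) atTop (𝓝 (f ξ)) := by
  have h0 : Tendsto (fun n : ℕ => (mollifier n).rOut) atTop (𝓝 0) := by
    simpa [mollifier] using (tendsto_one_div_add_atTop_nhds_zero_nat (𝕜 := ℝ)).const_mul 2
  have := ContDiffBump.ae_convolution_tendsto_right_of_locallyIntegrable (μ := (volume : Measure R3))
    (K := 2) h0 (Eventually.of_forall fun n => le_rfl) h.locallyIntegrable
  simpa only [h.apply_mollifierTest] using this

theorem measurable_limUnder_atTop {α : Type*} [MeasurableSpace α] {f : ℕ → α → ℂ}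
    (hf : ∀ n, Measurable (f n)) : Measurable fun x => limUnder atTop fun n => f n x :=
  (StronglyMeasurable.limUnder fun n => (hf n).stronglyMeasurable).measurable

/-- The representative is rebuilt from countably many scalar functions of time: the pairings with
mollifiers centred at the points of a dense sequence. Continuity in the centre extends them to all
centres, and Lebesgue differentiation recovers the function as the mollifiers shrink. Limits of
measurable functions remain jointly measurable; at the exceptional times their values are
irrelevant. -/
theorem exists_measurable_represents {μ : Measure ℝ} {v : ℝ → Distr}
    (hv : ∀ φ : 𝓢(R3, ℂ), AEMeasurable (fun t => v t φ) μ)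
    (hr : ∀ᵐ t ∂μ, ∃ g, Represents (v t) g) :
    ∃ V : ℝ → R3 → ℂ, Measurable (Function.uncurry V) ∧ ∀ᵐ t ∂μ, Represents (v t) (V t) := by
  let D : ℕ → R3 := TopologicalSpace.denseSeq R3
  choose a ha haev using fun n m => hv (mollifierTest n (D m))
  -- The centre `ξ` is replaced by a nearest point among finitely many terms of the dense sequence,
  -- so the space variable enters through a discrete index and joint measurability is immediate.
  let W' : ℕ → ℕ → ℝ × R3 → ℂ := fun n k p => a n (SimpleFunc.nearestPtInd D k p.2) p.1
  have hW' : ∀ n k, Measurable (W' n k) := by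
    intro n k
    have h1 : Measurable (fun p : ℝ × ℕ => a n p.2 p.1) :=
      measurable_from_prod_countable_left fun m => ha n m
    exact h1.comp (measurable_fst.prodMk
      ((SimpleFunc.nearestPtInd D k).measurable.comp measurable_snd))
  let W : ℕ → ℝ × R3 → ℂ := fun n p => limUnder atTop (fun k => W' n k p)
  have hW : ∀ n, Measurable (W n) := fun n =>
    measurable_limUnder_atTop fun k => hW' n k
  let V : ℝ → R3 → ℂ := fun t ξ => limUnder atTop (fun n => W n (t, ξ))
  have hV : Measurable (Function.uncurry V) :=
    measurable_limUnder_atTop hW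
  refine ⟨V, hV, ?_⟩
  have hae : ∀ᵐ t ∂μ, ∀ n m, v t (mollifierTest n (D m)) = a n m t :=
    ae_all_iff.2 fun n => ae_all_iff.2 fun m => haev n m
  filter_upwards [hr, hae] with t ⟨g, hg⟩ ht
  have hWt : ∀ n ξ, W n (t, ξ) = v t (mollifierTest n ξ) := by
    intro n ξ
    refine Tendsto.limUnder_eq ?_
    have h1 : Tendsto (fun k => SimpleFunc.nearestPt D k ξ) atTop (𝓝 ξ) :=
      SimpleFunc.tendsto_nearestPt (TopologicalSpace.denseRange_denseSeq R3 ξ)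
    refine ((hg.continuous_apply_mollifierTest n).tendsto ξ |>.comp h1).congr fun k => ?_
    simp only [W', Function.comp_apply, ← ht]
    rfl
  refine hg.congr_ae ?_
  filter_upwards [hg.ae_tendsto_mollifierTest] with ξ hξ
  simp only [V, hWt]
  exact hξ.limUnder_eq.symm

/-! ### Weighted `L²` estimates for convolutions -/

/-- The square of the weighted `L²` norm with weight `|ξ|^s`. -/
def energy (s : ℝ) (f : R3 → ℝ≥0∞) : ℝ≥0∞ := ∫⁻ ξ, ‖ξ‖ₑ ^ s * f ξ ^ 2

/-- The convolution of two nonnegative functions. -/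
def econv (f g : R3 → ℝ≥0∞) (ξ : R3) : ℝ≥0∞ := ∫⁻ η, f (ξ - η) * g η

theorem sq_lintegral_mul_le {α : Type*} [MeasurableSpace α] {μ : Measure α} {f g : α → ℝ≥0∞}
    (hf : AEMeasurable f μ) (hg : AEMeasurable g μ) :
    (∫⁻ x, f x * g x ∂μ) ^ 2 ≤ (∫⁻ x, f x ^ 2 ∂μ) * ∫⁻ x, g x ^ 2 ∂μ := by
  have h := ENNReal.lintegral_mul_le_Lp_mul_Lq μ (p := 2) (q := 2)
    (by constructor <;> norm_num) hf hg
  have h2 := pow_le_pow_left₀ (zero_le (a := _)) h 2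
  simp only [Pi.mul_apply] at h2
  refine h2.trans_eq ?_
  rw [mul_pow]
  simp only [← ENNReal.rpow_natCast, ← ENNReal.rpow_mul]
  norm_num

/-- Negative powers of `‖ξ‖ₑ` are `∞` at the origin, where the law of exponents fails; the weighted
identities are therefore proved off this null set. -/
theorem ae_ne_zero : ∀ᵐ ξ : R3, ξ ≠ 0 := by
  simp [ae_iff, measure_singleton]

theorem enorm_rpow_mul_rpow {ξ : R3} (hξ : ξ ≠ 0) (a b : ℝ) :
    ‖ξ‖ₑ ^ a * ‖ξ‖ₑ ^ b = ‖ξ‖ₑ ^ (a + b) :=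
  (ENNReal.rpow_add a b (by simpa using hξ) enorm_ne_top).symm

theorem sq_enorm_rpow (ξ : R3) (a : ℝ) : (‖ξ‖ₑ ^ a) ^ 2 = ‖ξ‖ₑ ^ (2 * a) := by
  rw [← ENNReal.rpow_natCast, ← ENNReal.rpow_mul, mul_comm]
  norm_num

theorem measurable_enorm_rpow (a : ℝ) : Measurable fun ξ : R3 => ‖ξ‖ₑ ^ a := by fun_prop

theorem energy_mono {s : ℝ} {f g : R3 → ℝ≥0∞} (h : ∀ᵐ ξ, f ξ ≤ g ξ) : energy s f ≤ energy s g := by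
  refine lintegral_mono_ae ?_
  filter_upwards [h] with ξ hξ
  gcongr

theorem energy_zero (f : R3 → ℝ≥0∞) : energy 0 f = ∫⁻ ξ, f ξ ^ 2 := by simp [energy]

theorem sq_add_le (a b : ℝ≥0∞) : (a + b) ^ 2 ≤ 2 * (a ^ 2 + b ^ 2) := by
  have h := ENNReal.rpow_add_le_mul_rpow_add_rpow a b (p := 2) (by norm_num)
  norm_num at h
  exact h

theorem energy_add_le {s : ℝ} {f g : R3 → ℝ≥0∞} (hf : Measurable f) :
    energy s (fun ξ => f ξ + g ξ) ≤ 2 * (energy s f + energy s g) := by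
  rw [energy, energy, energy, ← lintegral_add_left (by fun_prop), ← lintegral_const_mul' _ _ (by simp)]
  refine lintegral_mono fun ξ => ?_
  calc ‖ξ‖ₑ ^ s * (f ξ + g ξ) ^ 2 ≤ ‖ξ‖ₑ ^ s * (2 * (f ξ ^ 2 + g ξ ^ 2)) := by
        gcongr; exact sq_add_le _ _
    _ = _ := by ring

theorem energy_const_mul {s : ℝ} {f : R3 → ℝ≥0∞} (hf : Measurable f) (c : ℝ≥0∞) :
    energy s (fun ξ => c * f ξ) = c ^ 2 * energy s f := by
  rw [energy, energy, ← lintegral_const_mul _ (by fun_prop)]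
  exact lintegral_congr fun ξ => by ring

theorem energy_enorm_rpow_mul {s a : ℝ} {f : R3 → ℝ≥0∞} :
    energy s (fun ξ => ‖ξ‖ₑ ^ a * f ξ) = energy (s + 2 * a) f := by
  refine lintegral_congr_ae ?_
  filter_upwards [ae_ne_zero] with ξ hξ
  rw [mul_pow, sq_enorm_rpow, ← mul_assoc, enorm_rpow_mul_rpow hξ]

/-- Interpolation between weighted `L²` spaces. -/
theorem sq_energy_le {a b c : ℝ} (h : 2 * b = a + c) {f : R3 → ℝ≥0∞} (hf : Measurable f) :
    energy b f ^ 2 ≤ energy a f * energy c f := by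
  have h1 := sq_lintegral_mul_le (μ := (volume : Measure R3))
    (f := fun ξ => ‖ξ‖ₑ ^ (a / 2) * f ξ) (g := fun ξ => ‖ξ‖ₑ ^ (c / 2) * f ξ)
    (by fun_prop) (by fun_prop)
  have e : ∫⁻ ξ : R3, (‖ξ‖ₑ ^ (a / 2) * f ξ) * (‖ξ‖ₑ ^ (c / 2) * f ξ) = energy b f := by
    refine lintegral_congr_ae ?_
    filter_upwards [ae_ne_zero] with ξ hξ
    rw [show b = a / 2 + c / 2 by linarith, ← enorm_rpow_mul_rpow hξ]
    ring
  have e' : ∀ r : ℝ, ∫⁻ ξ : R3, (‖ξ‖ₑ ^ (r / 2) * f ξ) ^ 2 = energy r f := by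
    intro r
    refine lintegral_congr fun ξ => ?_
    rw [mul_pow, sq_enorm_rpow]
    ring_nf
  rwa [e, e', e'] at h1

theorem econv_comm (f g : R3 → ℝ≥0∞) : econv f g = econv g f := by
  ext ξ
  rw [econv, econv, ← lintegral_sub_left_eq_self _ ξ]
  refine lintegral_congr fun η => ?_
  rw [sub_sub_cancel, mul_comm]

/-- Scaling by `‖ξ‖` reduces to the unit ball: the volume contributes the exponent `3` and the
integrand `-α`. The constant is the integral over the unit ball, finite because `α < 3`. -/
theorem lintegral_closedBall_enorm_rpow {α : ℝ} (hα : α < 3) :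
    ∃ C : ℝ≥0∞, C ≠ ∞ ∧ ∀ ξ : R3, ξ ≠ 0 →
      ∫⁻ η in Metric.closedBall (0 : R3) ‖ξ‖, ‖η‖ₑ ^ (-α) = C * ‖ξ‖ₑ ^ (3 - α) := by
  refine ⟨∫⁻ η in Metric.closedBall (0 : R3) 1, ‖η‖ₑ ^ (-α), ?_, fun ξ hξ => ?_⟩
  · have hi : IntegrableOn (fun η : R3 => ‖η‖ ^ (-α)) (Metric.ball 0 2) volume := by
      refine integrableOn_ball_of_norm_le_rpow (C := 1) (α := α) (by simp) (by simpa using hα)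
        (ae_of_all _ fun x => ?_) (measurable_norm.pow_const _).aestronglyMeasurable
      rw [Real.norm_of_nonneg (by positivity), one_mul]
    have hlt := hi.2
    refine (lt_of_le_of_lt ?_ hlt).ne
    refine (lintegral_mono_set (Metric.closedBall_subset_ball one_lt_two)).trans
      (lintegral_mono_ae (ae_restrict_of_ae ?_))
    filter_upwards [ae_ne_zero] with η hη
    have : 0 < ‖η‖ := norm_pos_iff.2 hη
    rw [Real.enorm_eq_ofReal (by positivity), ← ofReal_norm, ENNReal.ofReal_rpow_of_pos this]
  · have hR : 0 < ‖ξ‖ := norm_pos_iff.2 hξ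
    have hmap := Measure.map_addHaar_smul (volume : Measure R3) hR.ne'
    have hfin : Module.finrank ℝ R3 = 3 := by simp
    rw [hfin] at hmap
    let F : R3 → ℝ≥0∞ := (Metric.closedBall (0 : R3) ‖ξ‖).indicator fun η => ‖η‖ₑ ^ (-α)
    have hF : Measurable F := (measurable_enorm_rpow _).indicator measurableSet_closedBall
    have h1 : ∫⁻ x, F (‖ξ‖ • x) = ENNReal.ofReal |(‖ξ‖ ^ 3)⁻¹| * ∫⁻ x, F x := by
      rw [← lintegral_map hF (measurable_const_smul _), hmap, lintegral_smul_measure, smul_eq_mul]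
    have h2 : ∀ x, F (‖ξ‖ • x) =
        ‖ξ‖ₑ ^ (-α) * (Metric.closedBall (0 : R3) 1).indicator (fun η => ‖η‖ₑ ^ (-α)) x := by
      intro x
      have hiff : ‖ξ‖ • x ∈ Metric.closedBall (0 : R3) ‖ξ‖ ↔ x ∈ Metric.closedBall (0 : R3) 1 := by
        simp only [mem_closedBall_zero_iff, norm_smul, norm_norm]
        exact mul_le_iff_le_one_right hR
      by_cases hx : x ∈ Metric.closedBall (0 : R3) 1
      · rw [indicator_of_mem hx]
        simp only [F]
        rw [indicator_of_mem (hiff.2 hx), enorm_smul, enorm_norm]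
        exact ENNReal.mul_rpow_of_ne_top enorm_ne_top enorm_ne_top _
      · rw [indicator_of_notMem hx]
        simp only [F]
        rw [indicator_of_notMem (fun h => hx (hiff.1 h)), mul_zero]
    simp only [h2] at h1
    rw [lintegral_const_mul _ ((measurable_enorm_rpow _).indicator measurableSet_closedBall),
      lintegral_indicator measurableSet_closedBall, lintegral_indicator measurableSet_closedBall]
      at h1
    have h3 : ENNReal.ofReal |(‖ξ‖ ^ 3)⁻¹| = ‖ξ‖ₑ ^ (-3 : ℝ) := by
      rw [abs_of_nonneg (by positivity), ← ofReal_norm, ENNReal.ofReal_rpow_of_pos hR,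
        Real.rpow_neg hR.le]
      norm_cast
    rw [h3] at h1
    calc ∫⁻ η in Metric.closedBall (0 : R3) ‖ξ‖, ‖η‖ₑ ^ (-α)
        = ‖ξ‖ₑ ^ (3 : ℝ) * (‖ξ‖ₑ ^ (-3 : ℝ) *
            ∫⁻ η in Metric.closedBall (0 : R3) ‖ξ‖, ‖η‖ₑ ^ (-α)) := by
          rw [← mul_assoc, enorm_rpow_mul_rpow hξ, add_neg_cancel, ENNReal.rpow_zero, one_mul]
      _ = _ := by
          rw [← h1, ← mul_assoc, enorm_rpow_mul_rpow hξ, mul_comm, ← sub_eq_add_neg]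

/-- The product of an `L²` function and an `Ḣ¹` function is in `Ḣ^{-1/2}`. -/
theorem exists_energy_econv_le : ∃ C : ℝ≥0∞, C ≠ ∞ ∧ ∀ f g : R3 → ℝ≥0∞, Measurable f →
    Measurable g → energy (-1) (econv f g) ≤ C * (energy 0 f * energy 2 g) := by
  obtain ⟨C₁, hC₁, h₁⟩ := lintegral_closedBall_enorm_rpow (α := 2) (by norm_num)
  obtain ⟨C₂, hC₂, h₂⟩ := lintegral_closedBall_enorm_rpow (α := 1) (by norm_num)
  refine ⟨2 * (C₁ + C₂), by finiteness, fun f g hf hg => ?_⟩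
  let S : R3 → Set R3 := fun ξ => Metric.closedBall 0 ‖ξ‖
  have hS : ∀ ξ, MeasurableSet (S ξ) := fun ξ => measurableSet_closedBall
  have hmono : ∀ ξ : R3, ∫⁻ η, f (ξ - η) ^ 2 = ∫⁻ η, f η ^ 2 := fun ξ =>
    lintegral_sub_left_eq_self (fun η => f η ^ 2) ξ
  -- low frequencies of `g`
  have hlow : ∀ ξ : R3, ξ ≠ 0 → ‖ξ‖ₑ ^ (-1 : ℝ) * (∫⁻ η in S ξ, f (ξ - η) * g η) ^ 2 ≤
      C₁ * ∫⁻ η, f (ξ - η) ^ 2 * (‖η‖ₑ ^ (2 : ℝ) * g η ^ 2) := by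
    intro ξ hξ
    -- Splitting off `|η|⁻¹` before Cauchy–Schwarz produces `∫_{|η| ≤ |ξ|} |η|⁻² = C₁ |ξ|`, which
    -- cancels the weight `|ξ|⁻¹`.
    have e : ∫⁻ η in S ξ, f (ξ - η) * g η =
        ∫⁻ η in S ξ, ‖η‖ₑ ^ (-1 : ℝ) * (f (ξ - η) * (‖η‖ₑ ^ (1 : ℝ) * g η)) := by
      refine lintegral_congr_ae (ae_restrict_of_ae ?_)
      filter_upwards [ae_ne_zero] with η hη
      have := enorm_rpow_mul_rpow hη (-1) 1
      calc f (ξ - η) * g η = (‖η‖ₑ ^ (-1 : ℝ) * ‖η‖ₑ ^ (1 : ℝ)) * (f (ξ - η) * g η) := by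
            rw [this]; simp
        _ = _ := by ring
    have hcs := sq_lintegral_mul_le (μ := volume.restrict (S ξ))
      (f := fun η : R3 => ‖η‖ₑ ^ (-1 : ℝ))
      (g := fun η => f (ξ - η) * (‖η‖ₑ ^ (1 : ℝ) * g η)) (by fun_prop) (by fun_prop)
    rw [← e] at hcs
    simp only [mul_pow, sq_enorm_rpow] at hcs
    norm_num only at hcs
    have hc := h₁ ξ hξ
    norm_num only at hc
    rw [hc] at hcs
    calc _ ≤ ‖ξ‖ₑ ^ (-1 : ℝ) * (C₁ * ‖ξ‖ₑ ^ (1 : ℝ) *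
          ∫⁻ η in S ξ, f (ξ - η) ^ 2 * (‖η‖ₑ ^ (2 : ℝ) * g η ^ 2)) := by gcongr
      _ = (‖ξ‖ₑ ^ (-1 : ℝ) * ‖ξ‖ₑ ^ (1 : ℝ)) * (C₁ *
          ∫⁻ η in S ξ, f (ξ - η) ^ 2 * (‖η‖ₑ ^ (2 : ℝ) * g η ^ 2)) := by ring
      _ ≤ _ := by
        rw [enorm_rpow_mul_rpow hξ]
        simp only [neg_add_cancel, ENNReal.rpow_zero, one_mul]
        gcongr
        exact Measure.restrict_le_self
  -- high frequencies of `g`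
  have hhigh : ∀ ξ : R3, (∫⁻ η in (S ξ)ᶜ, f (ξ - η) * g η) ^ 2 ≤
      energy 0 f * ∫⁻ η in (S ξ)ᶜ, g η ^ 2 := by
    intro ξ
    refine (sq_lintegral_mul_le (by fun_prop) (by fun_prop)).trans ?_
    rw [energy_zero, ← hmono ξ]
    gcongr
    exact Measure.restrict_le_self
  have hpt : ∀ᵐ ξ : R3, ‖ξ‖ₑ ^ (-1 : ℝ) * econv f g ξ ^ 2 ≤
      2 * (C₁ * ∫⁻ η, f (ξ - η) ^ 2 * (‖η‖ₑ ^ (2 : ℝ) * g η ^ 2)) +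
      2 * (energy 0 f * ∫⁻ η, (S ξ)ᶜ.indicator (fun η => ‖ξ‖ₑ ^ (-1 : ℝ) * g η ^ 2) η) := by
    filter_upwards [ae_ne_zero] with ξ hξ
    rw [lintegral_indicator (hS ξ).compl, lintegral_const_mul _ (by fun_prop), econv,
      ← lintegral_add_compl _ (hS ξ)]
    refine (mul_le_mul_right (sq_add_le _ _) _).trans ?_
    calc _ = 2 * (‖ξ‖ₑ ^ (-1 : ℝ) * (∫⁻ η in S ξ, f (ξ - η) * g η) ^ 2) +
          2 * (‖ξ‖ₑ ^ (-1 : ℝ) * (∫⁻ η in (S ξ)ᶜ, f (ξ - η) * g η) ^ 2) := by ring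
      _ ≤ 2 * (C₁ * ∫⁻ η, f (ξ - η) ^ 2 * (‖η‖ₑ ^ (2 : ℝ) * g η ^ 2)) +
          2 * (‖ξ‖ₑ ^ (-1 : ℝ) * (energy 0 f * ∫⁻ η in (S ξ)ᶜ, g η ^ 2)) := by
        exact add_le_add (mul_le_mul_right (hlow ξ hξ) _)
          (mul_le_mul_right (mul_le_mul_right (hhigh ξ) _) _)
      _ = _ := by ring
  have hmeas1 : Measurable (Function.uncurry fun ξ η : R3 =>
      f (ξ - η) ^ 2 * (‖η‖ₑ ^ (2 : ℝ) * g η ^ 2)) := by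
    simp only [Function.uncurry_def]
    fun_prop
  have hset : MeasurableSet {p : R3 × R3 | ‖p.1‖ < ‖p.2‖} :=
    measurableSet_lt (by fun_prop) (by fun_prop)
  have hind : (Function.uncurry fun ξ η : R3 =>
      (S ξ)ᶜ.indicator (fun η => ‖ξ‖ₑ ^ (-1 : ℝ) * g η ^ 2) η) =
      {p : R3 × R3 | ‖p.1‖ < ‖p.2‖}.indicator fun p => ‖p.1‖ₑ ^ (-1 : ℝ) * g p.2 ^ 2 := by
    ext ⟨ξ, η⟩
    simp [indicator, S, Function.uncurry]
  have hmeas2 : Measurable (Function.uncurry fun ξ η : R3 =>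
      (S ξ)ᶜ.indicator (fun η => ‖ξ‖ₑ ^ (-1 : ℝ) * g η ^ 2) η) := by
    rw [hind]
    refine Measurable.indicator ?_ hset
    fun_prop
  -- The integral of a convolution of nonnegative functions is the product of their integrals.
  have hI1 : ∫⁻ ξ, ∫⁻ η, f (ξ - η) ^ 2 * (‖η‖ₑ ^ (2 : ℝ) * g η ^ 2) =
      energy 0 f * energy 2 g := by
    rw [lintegral_lintegral_swap hmeas1.aemeasurable, energy_zero, energy,
      ← lintegral_const_mul _ (by fun_prop)]
    refine lintegral_congr fun η => ?_
    rw [lintegral_mul_const _ (by fun_prop), lintegral_sub_right_eq_self (fun ξ => f ξ ^ 2) η]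
  -- After Tonelli, `ξ` ranges over `|ξ| < |η|` for fixed `η`, and `|ξ|⁻¹` has integral at most `C₂
  -- |η|²` there.
  have hI2 : ∫⁻ ξ, ∫⁻ η, (S ξ)ᶜ.indicator (fun η => ‖ξ‖ₑ ^ (-1 : ℝ) * g η ^ 2) η ≤
      C₂ * energy 2 g := by
    rw [lintegral_lintegral_swap hmeas2.aemeasurable, energy, ← lintegral_const_mul _ (by fun_prop)]
    refine lintegral_mono_ae ?_
    filter_upwards [ae_ne_zero] with η hη
    have hle : ∀ ξ : R3, (S ξ)ᶜ.indicator (fun η => ‖ξ‖ₑ ^ (-1 : ℝ) * g η ^ 2) η ≤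
        (Metric.closedBall (0 : R3) ‖η‖).indicator (fun ξ => ‖ξ‖ₑ ^ (-1 : ℝ) * g η ^ 2) ξ := by
      intro ξ
      by_cases h : ‖ξ‖ ≤ ‖η‖
      · rw [indicator_of_mem (by simpa using h : ξ ∈ Metric.closedBall (0 : R3) ‖η‖)]
        exact indicator_le_self _ (fun η => ‖ξ‖ₑ ^ (-1 : ℝ) * g η ^ 2) η
      · rw [indicator_of_notMem]
        · exact zero_le
        · simpa [S] using (not_le.1 h).le
    refine (lintegral_mono hle).trans_eq ?_
    rw [lintegral_indicator measurableSet_closedBall, lintegral_mul_const _ (by fun_prop), h₂ η hη]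
    norm_num only
    ring
  calc energy (-1) (econv f g) ≤ _ := lintegral_mono_ae hpt
    _ = 2 * (C₁ * (energy 0 f * energy 2 g)) + 2 * (energy 0 f *
        ∫⁻ ξ, ∫⁻ η, (S ξ)ᶜ.indicator (fun η => ‖ξ‖ₑ ^ (-1 : ℝ) * g η ^ 2) η) := by
      have m1 : Measurable fun ξ => ∫⁻ η, f (ξ - η) ^ 2 * (‖η‖ₑ ^ (2 : ℝ) * g η ^ 2) :=
        hmeas1.lintegral_prod_right'
      have m2 : Measurable fun ξ => ∫⁻ η, (S ξ)ᶜ.indicator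
          (fun η => ‖ξ‖ₑ ^ (-1 : ℝ) * g η ^ 2) η := hmeas2.lintegral_prod_right'
      rw [lintegral_add_left ((m1.const_mul _).const_mul _),
        lintegral_const_mul _ (m1.const_mul _), lintegral_const_mul _ m1,
        lintegral_const_mul _ (m2.const_mul _), lintegral_const_mul _ m2, hI1]
    _ ≤ 2 * (C₁ * (energy 0 f * energy 2 g)) + 2 * (energy 0 f * (C₂ * energy 2 g)) := by gcongr
    _ = _ := by ring

theorem measurable_econv {f g : R3 → ℝ≥0∞} (hf : Measurable f) (hg : Measurable g) :
    Measurable (econv f g) := by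
  have h : Measurable (Function.uncurry fun ξ η : R3 => f (ξ - η) * g η) := by
    simp only [Function.uncurry_def]
    fun_prop
  exact h.lintegral_prod_right'

/-- The product of two `Ḣ¹` functions is in `Ḣ^{1/2}`. -/
theorem exists_energy_one_econv_le : ∃ C : ℝ≥0∞, C ≠ ∞ ∧ ∀ f g : R3 → ℝ≥0∞, Measurable f →
    Measurable g → energy 1 (econv f g) ≤ C * (energy 2 f * energy 2 g) := by
  obtain ⟨C, hC, h⟩ := exists_energy_econv_le
  refine ⟨2 * (C + C), by finiteness, fun f g hf hg => ?_⟩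
  let f' : R3 → ℝ≥0∞ := fun ξ => ‖ξ‖ₑ ^ (1 : ℝ) * f ξ
  let g' : R3 → ℝ≥0∞ := fun ξ => ‖ξ‖ₑ ^ (1 : ℝ) * g ξ
  have hf' : Measurable f' := by fun_prop
  have hg' : Measurable g' := by fun_prop
  have hf0 : energy 0 f' = energy 2 f := by
    simp only [f', energy_enorm_rpow_mul]
    norm_num
  have hg0 : energy 0 g' = energy 2 g := by
    simp only [g', energy_enorm_rpow_mul]
    norm_num
  -- A Leibniz rule on the Fourier side: `|ξ| ≤ |ξ - η| + |η|` puts one derivative on either factor,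
  -- leaving a product of an `L²` and an `Ḣ¹` function.
  have hpt : ∀ ξ, ‖ξ‖ₑ ^ (1 : ℝ) * econv f g ξ ≤ econv f' g ξ + econv g' f ξ := by
    intro ξ
    rw [econv_comm g' f, econv, econv, econv, ← lintegral_add_left (by fun_prop),
      ← lintegral_const_mul _ (by fun_prop)]
    refine lintegral_mono fun η => ?_
    have htri : ‖ξ‖ₑ ≤ ‖ξ - η‖ₑ + ‖η‖ₑ := by
      calc ‖ξ‖ₑ = ‖(ξ - η) + η‖ₑ := by rw [sub_add_cancel]
        _ ≤ _ := enorm_add_le _ _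
    simp only [f', g', ENNReal.rpow_one]
    calc _ ≤ (‖ξ - η‖ₑ + ‖η‖ₑ) * (f (ξ - η) * g η) := by gcongr
      _ = _ := by ring
  calc energy 1 (econv f g) = energy (-1) (fun ξ => ‖ξ‖ₑ ^ (1 : ℝ) * econv f g ξ) := by
        rw [energy_enorm_rpow_mul]
        norm_num
    _ ≤ energy (-1) (fun ξ => econv f' g ξ + econv g' f ξ) := energy_mono (ae_of_all _ hpt)
    _ ≤ 2 * (energy (-1) (econv f' g) + energy (-1) (econv g' f)) :=
        energy_add_le (measurable_econv hf' hg)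
    _ ≤ 2 * (C * (energy 0 f' * energy 2 g) + C * (energy 0 g' * energy 2 f)) := by
        gcongr
        · exact h _ _ hf' hg
        · exact h _ _ hg' hf
    _ = _ := by
        rw [hf0, hg0]
        ring

theorem enorm_conv_le_econv (f g : R3 → ℂ) (ξ : R3) :
    ‖conv f g ξ‖ₑ ≤ econv (fun ξ => ‖f ξ‖ₑ) (fun ξ => ‖g ξ‖ₑ) ξ := by
  refine (enorm_integral_le_lintegral_enorm _).trans_eq ?_
  simp only [enorm_mul, econv]

/-! ### A Gronwall lemma -/

/-- Let `F t` be the integral on the right and `S` the supremum of its zeros. Were `S < T`, a short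
interval `(S, s]` on which `b` has mass at most `1/2` would give `F s ≤ F s / 2`, hence `F s = 0`,
contradicting the choice of `S`. Neither continuity nor measurability of `E` is needed. -/
theorem ae_eq_zero_of_le_lintegral {T : ℝ} {E b : ℝ → ℝ≥0∞}
    (hb : ∫⁻ t in Icc 0 T, b t ≠ ∞) (hbE : ∫⁻ t in Icc 0 T, b t * E t ≠ ∞)
    (h : ∀ᵐ t ∂(volume.restrict (Icc 0 T)), E t ≤ ∫⁻ τ in Icc 0 t, b τ * E τ) :
    ∀ᵐ t ∂(volume.restrict (Icc 0 T)), E t = 0 := by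
  rcases lt_or_ge T 0 with hT | hT
  · simp [Icc_eq_empty (not_le.2 hT)]
  let F : ℝ → ℝ≥0∞ := fun t => ∫⁻ τ in Icc 0 t, b τ * E τ
  have hF : Monotone F := fun s t hst => lintegral_mono_set (Icc_subset_Icc_right hst)
  suffices hFT : F T = 0 by
    filter_upwards [h, ae_restrict_mem measurableSet_Icc] with t ht htT
    exact le_antisymm (ht.trans ((hF htT.2).trans hFT.le)) zero_le
  let Z : Set ℝ := {t | t ∈ Icc 0 T ∧ F t = 0}
  have h0 : (0 : ℝ) ∈ Z := ⟨⟨le_rfl, hT⟩, by simp [F]⟩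
  have hZT : ∀ t ∈ Z, t ≤ T := fun t ht => ht.1.2
  have hbdd : BddAbove Z := ⟨T, hZT⟩
  set S := sSup Z with hS
  have hS0 : 0 ≤ S := le_csSup hbdd h0
  have hST : S ≤ T := csSup_le ⟨0, h0⟩ hZT
  -- The supremum is attained: `[0, S]` is covered by countably many intervals ending at zeros of
  -- `F`, together with one point.
  have hFS : F S = 0 := by
    obtain ⟨s, -, hs, hsZ⟩ := exists_seq_tendsto_sSup ⟨0, h0⟩ hbdd
    let ν : Measure ℝ := volume.withDensity fun t => b t * E t
    have hν : ∀ t, ν (Icc 0 t) = F t := fun t => withDensity_apply _ measurableSet_Icc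
    have hsub : Icc 0 S ⊆ (⋃ n, Icc 0 (s n)) ∪ {S} := by
      intro t ht
      rcases eq_or_lt_of_le ht.2 with rfl | hlt
      · exact Or.inr rfl
      · obtain ⟨n, hn⟩ := (hs.eventually (lt_mem_nhds hlt)).exists
        exact Or.inl (mem_iUnion.2 ⟨n, ht.1, hn.le⟩)
    rw [← hν]
    refine measure_mono_null hsub (measure_union_null (measure_iUnion_null fun n => ?_) ?_)
    · rw [hν]
      exact (hsZ n).2
    · exact withDensity_absolutelyContinuous _ _ (measure_singleton S)
  rcases eq_or_lt_of_le hST with hST' | hlt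
  · rw [← hST']
    exact hFS
  exfalso
  -- Absolute continuity of the integral of `b` determines the length of the step beyond `S`.
  obtain ⟨δ, hδ, hδb⟩ := exists_pos_setLIntegral_lt_of_measure_lt hb
    (ε := 1 / 2) (by simp)
  obtain ⟨r, hr0, hrδ⟩ : ∃ r : ℝ, 0 < r ∧ ENNReal.ofReal r < δ := by
    obtain ⟨q, hq0, hq⟩ := ENNReal.lt_iff_exists_real_btwn.1 hδ
    exact ⟨q, ENNReal.ofReal_pos.1 hq.1, hq.2⟩
  let s := min T (S + r)
  have hSs : S < s := lt_min hlt (by linarith)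
  have hsT : s ≤ T := min_le_left _ _
  have hbs : ∫⁻ τ in Ioc S s, b τ ≤ 1 / 2 := by
    have hsub : Ioc S s ⊆ Icc 0 T := fun x hx => ⟨hS0.trans hx.1.le, hx.2.trans hsT⟩
    have hv : (volume.restrict (Icc 0 T)) (Ioc S s) < δ := by
      refine (Measure.restrict_apply_le _ _).trans_lt ?_
      rw [Real.volume_Ioc]
      refine (ENNReal.ofReal_le_ofReal ?_).trans_lt hrδ
      have : s ≤ S + r := min_le_right _ _
      linarith
    have := hδb _ hv
    rw [Measure.restrict_restrict measurableSet_Ioc, inter_eq_left.2 hsub] at this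
    exact this.le
  have hFs : F s ≠ ∞ := ne_top_of_le_ne_top hbE (hF hsT)
  have hle : F s ≤ F s * (1 / 2) := by
    have hsplit : Icc 0 s = Icc 0 S ∪ Ioc S s := (Icc_union_Ioc_eq_Icc hS0 hSs.le).symm
    calc F s ≤ F S + ∫⁻ τ in Ioc S s, b τ * E τ := by
          simp only [F, hsplit]
          exact lintegral_union_le _ _ _
      _ = ∫⁻ τ in Ioc S s, b τ * E τ := by rw [hFS, zero_add]
      _ ≤ ∫⁻ τ in Ioc S s, b τ * F s := by
          have hsub : Ioc S s ⊆ Icc 0 T := fun x hx => ⟨hS0.trans hx.1.le, hx.2.trans hsT⟩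
          refine lintegral_mono_ae ?_
          filter_upwards [ae_restrict_of_ae_restrict_of_subset hsub h,
            ae_restrict_mem measurableSet_Ioc] with τ hτ hτs
          exact mul_le_mul_right (hτ.trans (hF hτs.2)) _
      _ = F s * ∫⁻ τ in Ioc S s, b τ := by
          rw [lintegral_mul_const' _ _ hFs, mul_comm]
      _ ≤ _ := by gcongr
  have hFs0 : F s = 0 := by
    by_contra hne
    have h2 : F s * (1 / 2) < F s := by
      rw [one_div, ← div_eq_mul_inv]
      exact ENNReal.half_lt_self hne hFs
    exact absurd hle (not_le.2 h2)
  exact absurd (le_csSup hbdd (⟨⟨hS0.trans hSs.le, hsT⟩, hFs0⟩ : s ∈ Z)) (not_le.2 hSs)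

/-! ### Estimates for the Duhamel integral -/

/-- The causal heat kernel on the Fourier side. -/
def heatKernel (t : ℝ) (ξ : R3) : ℝ≥0∞ :=
  (Ici (0 : ℝ)).indicator (fun t => ENNReal.ofReal (heatSymbol t ξ)) t

/-- The Duhamel integral of a nonnegative function on the Fourier side. -/
def duhamel (n : ℝ → R3 → ℝ≥0∞) (t : ℝ) (ξ : R3) : ℝ≥0∞ :=
  ∫⁻ τ in Icc 0 t, heatKernel (t - τ) ξ * n τ ξ

theorem measurable_heatSymbol : Measurable (Function.uncurry heatSymbol) := by
  simp only [Function.uncurry_def, heatSymbol]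
  fun_prop

@[fun_prop]
theorem measurable_heatKernel : Measurable (Function.uncurry heatKernel) := by
  have : Function.uncurry heatKernel = ((Ici (0 : ℝ)) ×ˢ (univ : Set R3)).indicator
      (fun p => ENNReal.ofReal (Function.uncurry heatSymbol p)) := by
    ext ⟨t, ξ⟩
    simp [heatKernel, indicator, Function.uncurry]
  rw [this]
  exact measurable_heatSymbol.ennreal_ofReal.indicator (measurableSet_Ici.prod MeasurableSet.univ)

theorem heatSymbol_nonneg (t : ℝ) (ξ : R3) : 0 ≤ heatSymbol t ξ := Real.exp_nonneg _

theorem heatKernel_le_one (t : ℝ) (ξ : R3) : heatKernel t ξ ≤ 1 := by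
  rw [heatKernel, indicator]
  split_ifs with h
  · rw [ENNReal.ofReal_le_one, heatSymbol, Real.exp_le_one_iff]
    have : 0 ≤ t * (2 * Real.pi * ‖ξ‖) ^ 2 := mul_nonneg h (by positivity)
    linarith
  · exact zero_le

/-- The exact value is `1 / (4 π² |ξ|²)`; the factor `4 π² ≥ 1` is dropped. -/
theorem lintegral_heatKernel_le {ξ : R3} (hξ : ξ ≠ 0) :
    ∫⁻ t, heatKernel t ξ ≤ ‖ξ‖ₑ ^ (-2 : ℝ) := by
  have hpos : 0 < ‖ξ‖ := norm_pos_iff.2 hξ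
  have hl : 0 < (2 * Real.pi * ‖ξ‖) ^ 2 := by positivity
  have hi := exp_neg_integrableOn_Ioi 0 hl
  have e : ∫⁻ t, heatKernel t ξ =
      ENNReal.ofReal (∫ t in Ioi (0 : ℝ), Real.exp (-(2 * Real.pi * ‖ξ‖) ^ 2 * t)) := by
    simp only [heatKernel]
    rw [lintegral_indicator measurableSet_Ici, setLIntegral_congr Ioi_ae_eq_Ici.symm,
      ofReal_integral_eq_lintegral_ofReal hi (ae_of_all _ fun _ => (Real.exp_nonneg _))]
    refine lintegral_congr fun t => ?_
    rw [heatSymbol]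
    ring_nf
  rw [e, integral_exp_mul_Ioi (by linarith) 0, ← ofReal_norm, ENNReal.ofReal_rpow_of_pos hpos]
  refine ENNReal.ofReal_le_ofReal ?_
  rw [mul_zero, Real.exp_zero, Real.rpow_neg hpos.le, neg_div_neg_eq, one_div]
  norm_cast
  refine inv_anti₀ (by positivity) ?_
  rw [mul_pow]
  have : 1 ≤ (2 * Real.pi) ^ 2 := one_le_pow₀ (by linarith [Real.pi_gt_three])
  nlinarith [sq_nonneg ‖ξ‖]

/-- Cauchy–Schwarz in time with the kernel split into two square roots; the total mass of the kernel
supplies two negative powers of `|ξ|`. -/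
theorem sq_duhamel_le {n : ℝ → R3 → ℝ≥0∞} (hn : Measurable (Function.uncurry n)) (t : ℝ) {ξ : R3}
    (hξ : ξ ≠ 0) : duhamel n t ξ ^ 2 ≤
      ‖ξ‖ₑ ^ (-2 : ℝ) * ∫⁻ τ in Icc 0 t, heatKernel (t - τ) ξ * n τ ξ ^ 2 := by
  have hk : Measurable fun τ => heatKernel (t - τ) ξ :=
    measurable_heatKernel.comp ((measurable_const.sub measurable_id).prodMk measurable_const)
  have hn' : Measurable fun τ => n τ ξ := hn.comp (measurable_id.prodMk measurable_const)
  have hs : ∀ τ, (heatKernel (t - τ) ξ ^ (1 / 2 : ℝ)) ^ 2 = heatKernel (t - τ) ξ := by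
    intro τ
    rw [← ENNReal.rpow_natCast, ← ENNReal.rpow_mul]
    norm_num
  have h := sq_lintegral_mul_le (μ := volume.restrict (Icc 0 t))
    (f := fun τ => heatKernel (t - τ) ξ ^ (1 / 2 : ℝ))
    (g := fun τ => heatKernel (t - τ) ξ ^ (1 / 2 : ℝ) * n τ ξ) (by fun_prop) (by fun_prop)
  simp only [← mul_assoc, ← sq, mul_pow, hs] at h
  refine h.trans ?_
  gcongr
  refine (setLIntegral_le_lintegral _ _).trans ?_
  rw [lintegral_sub_left_eq_self (fun τ => heatKernel τ ξ) t]
  exact lintegral_heatKernel_le hξ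

theorem measurable_weighted_sq {n : ℝ → R3 → ℝ≥0∞} (hn : Measurable (Function.uncurry n)) (s : ℝ) :
    Measurable (Function.uncurry fun (τ : ℝ) (ξ : R3) => ‖ξ‖ₑ ^ s * n τ ξ ^ 2) := by
  have h1 : Measurable (fun p : ℝ × R3 => n p.1 p.2) := hn
  simp only [Function.uncurry_def]
  fun_prop

/-- The bound, uniform in time, for the Duhamel integral. -/
theorem energy_duhamel_le {n : ℝ → R3 → ℝ≥0∞} (hn : Measurable (Function.uncurry n)) (s t : ℝ) :
    energy s (duhamel n t) ≤ ∫⁻ τ in Icc 0 t, energy (s - 2) (n τ) := by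
  have hn' : Measurable (fun p : ℝ × R3 => n p.1 p.2) := hn
  simp only [energy]
  rw [lintegral_lintegral_swap (measurable_weighted_sq hn _).aemeasurable]
  refine lintegral_mono_ae ?_
  filter_upwards [ae_ne_zero] with ξ hξ
  rw [lintegral_const_mul _ (by fun_prop)]
  calc ‖ξ‖ₑ ^ s * duhamel n t ξ ^ 2
      ≤ ‖ξ‖ₑ ^ s * (‖ξ‖ₑ ^ (-2 : ℝ) * ∫⁻ τ in Icc 0 t, heatKernel (t - τ) ξ * n τ ξ ^ 2) := by
        gcongr
        exact sq_duhamel_le hn t hξ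
    _ = ‖ξ‖ₑ ^ (s - 2) * ∫⁻ τ in Icc 0 t, heatKernel (t - τ) ξ * n τ ξ ^ 2 := by
        rw [← mul_assoc, enorm_rpow_mul_rpow hξ, ← sub_eq_add_neg]
    _ ≤ _ := by
        gcongr with τ
        exact mul_le_of_le_one_left zero_le (heatKernel_le_one _ _)

theorem measurable_lintegral_heatKernel_conv {ξ : R3} {u : ℝ → ℝ≥0∞} (hu : Measurable u)
    (B : Set ℝ) : Measurable fun t => ∫⁻ τ in B, heatKernel (t - τ) ξ * u τ := by
  have hkξ : Measurable fun t => heatKernel t ξ := measurable_heatKernel.comp measurable_prodMk_right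
  have hm : Measurable fun p : ℝ × ℝ => heatKernel (p.1 - p.2) ξ * u p.2 := by fun_prop
  exact hm.lintegral_prod_right'

theorem lintegral_heatKernel_conv_le {ξ : R3} (hξ : ξ ≠ 0) {u : ℝ → ℝ≥0∞} (hu : Measurable u)
    (A B : Set ℝ) : ∫⁻ t in A, ∫⁻ τ in B, heatKernel (t - τ) ξ * u τ ≤
      ‖ξ‖ₑ ^ (-2 : ℝ) * ∫⁻ τ in B, u τ := by
  have hkξ : Measurable fun t => heatKernel t ξ := measurable_heatKernel.comp measurable_prodMk_right
  have hm : Measurable fun p : ℝ × ℝ => heatKernel (p.1 - p.2) ξ * u p.2 := by fun_prop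
  rw [lintegral_lintegral_swap (f := fun t τ => heatKernel (t - τ) ξ * u τ) hm.aemeasurable,
    ← lintegral_const_mul _ hu]
  refine lintegral_mono fun τ => ?_
  rw [lintegral_mul_const _ (by fun_prop)]
  gcongr
  refine (setLIntegral_le_lintegral _ _).trans ?_
  rw [lintegral_sub_right_eq_self (fun t => heatKernel t ξ) τ]
  exact lintegral_heatKernel_le hξ

/-- Maximal regularity for the Duhamel integral. -/
theorem lintegral_energy_duhamel_le {n : ℝ → R3 → ℝ≥0∞} (hn : Measurable (Function.uncurry n))
    (s T : ℝ) : ∫⁻ t in Icc 0 T, energy s (duhamel n t) ≤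
      ∫⁻ τ in Icc 0 T, energy (s - 4) (n τ) := by
  have hn' : Measurable (fun p : ℝ × R3 => n p.1 p.2) := hn
  have hk' : Measurable (fun p : ℝ × R3 => heatKernel p.1 p.2) := measurable_heatKernel
  have hk3 : Measurable fun q : (ℝ × R3) × ℝ => heatKernel (q.1.1 - q.2) q.1.2 * n q.2 q.1.2 ^ 2 :=
    (hk'.comp (by fun_prop : Measurable fun q : (ℝ × R3) × ℝ => (q.1.1 - q.2, q.1.2))).mul
      ((hn'.comp (by fun_prop : Measurable fun q : (ℝ × R3) × ℝ => (q.2, q.1.2))).pow_const 2)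
  have hm' : Measurable fun p : ℝ × R3 =>
      ∫⁻ τ in Icc 0 T, heatKernel (p.1 - τ) p.2 * n τ p.2 ^ 2 := hk3.lintegral_prod_right'
  have hm : Measurable (Function.uncurry fun (t : ℝ) (ξ : R3) =>
      ‖ξ‖ₑ ^ (s - 2) * ∫⁻ τ in Icc 0 T, heatKernel (t - τ) ξ * n τ ξ ^ 2) := by
    simp only [Function.uncurry_def]
    fun_prop
  calc ∫⁻ t in Icc 0 T, energy s (duhamel n t)
      ≤ ∫⁻ t in Icc 0 T, ∫⁻ ξ : R3, ‖ξ‖ₑ ^ (s - 2) *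
          ∫⁻ τ in Icc 0 T, heatKernel (t - τ) ξ * n τ ξ ^ 2 := by
        refine setLIntegral_mono' measurableSet_Icc fun t ht => ?_
        refine lintegral_mono_ae ?_
        filter_upwards [ae_ne_zero] with ξ hξ
        calc ‖ξ‖ₑ ^ s * duhamel n t ξ ^ 2
            ≤ ‖ξ‖ₑ ^ s * (‖ξ‖ₑ ^ (-2 : ℝ) *
                ∫⁻ τ in Icc 0 t, heatKernel (t - τ) ξ * n τ ξ ^ 2) := by
              gcongr
              exact sq_duhamel_le hn t hξ
          _ = ‖ξ‖ₑ ^ (s - 2) * ∫⁻ τ in Icc 0 t, heatKernel (t - τ) ξ * n τ ξ ^ 2 := by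
              rw [← mul_assoc, enorm_rpow_mul_rpow hξ, ← sub_eq_add_neg]
          _ ≤ _ := by
              -- The domain is made independent of `t` to allow Tonelli. Nothing is lost, because
              -- the causal kernel vanishes for `τ > t`.
              refine mul_le_mul_right ?_ _
              exact lintegral_mono_set (Icc_subset_Icc_right ht.2)
    _ = ∫⁻ ξ : R3, ∫⁻ t in Icc 0 T, ‖ξ‖ₑ ^ (s - 2) *
          ∫⁻ τ in Icc 0 T, heatKernel (t - τ) ξ * n τ ξ ^ 2 :=
        lintegral_lintegral_swap hm.aemeasurable
    -- Integrating the kernel in `t` gains another `|ξ|⁻²`, beyond the one from Cauchy–Schwarz.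
    _ ≤ ∫⁻ ξ : R3, ∫⁻ τ in Icc 0 T, ‖ξ‖ₑ ^ (s - 4) * n τ ξ ^ 2 := by
        refine lintegral_mono_ae ?_
        filter_upwards [ae_ne_zero] with ξ hξ
        have hnξ : Measurable fun τ => n τ ξ := hn'.comp measurable_prodMk_right
        have hm1 : Measurable fun t : ℝ => ∫⁻ τ in Icc 0 T, heatKernel (t - τ) ξ * n τ ξ ^ 2 :=
          measurable_lintegral_heatKernel_conv (hnξ.pow_const 2) _
        rw [lintegral_const_mul _ hm1, lintegral_const_mul _ (by fun_prop)]
        calc _ ≤ ‖ξ‖ₑ ^ (s - 2) * (‖ξ‖ₑ ^ (-2 : ℝ) * ∫⁻ τ in Icc 0 T, n τ ξ ^ 2) :=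
              mul_le_mul_right (lintegral_heatKernel_conv_le hξ (hnξ.pow_const 2) _ _) _
          _ = _ := by
              rw [← mul_assoc, enorm_rpow_mul_rpow hξ]
              ring_nf
    _ = _ := by
        simp only [energy]
        exact (lintegral_lintegral_swap (measurable_weighted_sq hn (s - 4)).aemeasurable).symm

/-! ### The mild formulation, pointwise on the Fourier side -/

theorem energy_schwartz_lt_top {s : ℝ} (h0 : 0 ≤ s) (h4 : s ≤ 4) (φ : 𝓢(R3, ℂ)) :
    energy s (fun ξ => ‖φ ξ‖ₑ) < ∞ := by
  have hg : (fun ξ : R3 => (((1 + ‖ξ‖ ^ 2) ^ (1 : ℝ) : ℝ) : ℂ)).HasTemperateGrowth :=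
    hasTemperateGrowth_besselWeight 1
  have h := ((SchwartzMap.smulLeftCLM ℂ (fun ξ : R3 => (((1 + ‖ξ‖ ^ 2) ^ (1 : ℝ) : ℝ) : ℂ)) φ).memLp 2
    (volume : Measure R3)).eLpNorm_lt_top
  rw [eLpNorm_lt_top_iff_lintegral_rpow_enorm_lt_top (by simp) (by simp)] at h
  refine lt_of_le_of_lt (lintegral_mono fun ξ => ?_) h
  rw [SchwartzMap.smulLeftCLM_apply_apply hg, smul_eq_mul, enorm_mul]
  simp only [ENNReal.toReal_ofNat, Real.rpow_one]
  rw [ENNReal.mul_rpow_of_nonneg _ _ (by norm_num)]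
  have h1 : ‖ξ‖ₑ ^ s ≤ ‖((1 + ‖ξ‖ ^ 2 : ℝ) : ℂ)‖ₑ ^ (2 : ℝ) := by
    rw [← ofReal_norm, ← ofReal_norm, ENNReal.ofReal_rpow_of_nonneg (norm_nonneg _) h0,
      ENNReal.ofReal_rpow_of_nonneg (norm_nonneg _) (by norm_num), Complex.norm_real,
      Real.norm_of_nonneg (by positivity)]
    refine ENNReal.ofReal_le_ofReal ?_
    rcases le_total ‖ξ‖ 1 with h | h
    · calc ‖ξ‖ ^ s ≤ 1 := Real.rpow_le_one (norm_nonneg _) h h0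
        _ ≤ _ := Real.one_le_rpow (by nlinarith [sq_nonneg ‖ξ‖]) (by norm_num)
    · calc ‖ξ‖ ^ s ≤ ‖ξ‖ ^ (4 : ℝ) := Real.rpow_le_rpow_of_exponent_le h h4
        _ = (‖ξ‖ ^ 2) ^ (2 : ℝ) := by
          rw [← Real.rpow_natCast, ← Real.rpow_mul (norm_nonneg _)]
          norm_num
        _ ≤ _ := by
          gcongr
          linarith
  refine mul_le_mul' h1 ?_
  norm_cast

/-- Fubini turns the weak time integral into a function defined by a time integral at each
frequency. Uniqueness of representatives equates it with `f`, and the triangle inequality concludes.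
The range of `s` ensures that the dual weight `|ξ|^{-s}` is harmless against Schwartz functions. -/
theorem ae_enorm_le_duhamel {S : Distr} {f : R3 → ℂ} (hS : Represents S f) {N : ℝ → R3 → ℂ}
    (hN : Measurable (Function.uncurry N)) {t s : ℝ} (ht : 0 ≤ t) (hs : s ≤ 0) (hs' : -4 ≤ s)
    (hfin : ∫⁻ τ in Icc 0 t, energy s (fun ξ => ‖N τ ξ‖ₑ) < ∞)
    (h : ∀ φ : 𝓢(R3, ℂ), S φ = ∫ τ in 0..t, ∫ ξ, φ ξ * ((heatSymbol (t - τ) ξ : ℂ) * N τ ξ)) :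
    ∀ᵐ ξ, ‖f ξ‖ₑ ≤ duhamel (fun τ ξ => ‖N τ ξ‖ₑ) t ξ := by
  have hN' : Measurable (fun p : ℝ × R3 => N p.1 p.2) := hN
  have hh : Measurable (fun p : ℝ × R3 => (heatSymbol (t - p.1) p.2 : ℂ)) :=
    Complex.measurable_ofReal.comp (measurable_heatSymbol.comp
      (by fun_prop : Measurable fun p : ℝ × R3 => (t - p.1, p.2)))
  have hhle : ∀ τ ∈ Ioc 0 t, ∀ ξ, ‖(heatSymbol (t - τ) ξ : ℂ)‖ₑ = heatKernel (t - τ) ξ := by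
    intro τ hτ ξ
    have : t - τ ∈ Ici (0 : ℝ) := by simpa using hτ.2
    rw [heatKernel, indicator_of_mem this, ← ofReal_norm, Complex.norm_real,
      Real.norm_of_nonneg (heatSymbol_nonneg _ _)]
  let G : R3 → ℂ := fun ξ => ∫ τ in Ioc 0 t, (heatSymbol (t - τ) ξ : ℂ) * N τ ξ
  have hG : Represents S G := by
    intro φ
    let P : ℝ × R3 → ℂ := fun p => φ p.2 * ((heatSymbol (t - p.1) p.2 : ℂ) * N p.1 p.2)
    have hP : Measurable P := (φ.continuous.measurable.comp measurable_snd).mul (hh.mul hN')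
    have hint : Integrable P ((volume.restrict (Ioc 0 t)).prod volume) := by
      refine ⟨hP.aestronglyMeasurable, ?_⟩
      rw [HasFiniteIntegral, lintegral_prod _ hP.enorm.aemeasurable]
      -- Duality between the weights `s` and `-s` bounds the square of the integral; `X ≤ 1 + X²`
      -- then avoids a square root, and the `1` is integrable on a bounded time interval.
      have hbound : ∀ τ ∈ Ioc 0 t, ∫⁻ ξ, ‖P (τ, ξ)‖ₑ ≤
          1 + energy s (fun ξ => ‖N τ ξ‖ₑ) * energy (-s) (fun ξ => ‖φ ξ‖ₑ) := by
        intro τ hτ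
        have hNτ : Measurable fun ξ => N τ ξ := hN'.comp measurable_prodMk_left
        have hφ : Measurable fun ξ => φ ξ := φ.continuous.measurable
        have hcs := sq_lintegral_mul_le (μ := (volume : Measure R3))
          (f := fun ξ => ‖ξ‖ₑ ^ (s / 2) * ‖N τ ξ‖ₑ) (g := fun ξ => ‖ξ‖ₑ ^ (-s / 2) * ‖φ ξ‖ₑ)
          (by fun_prop) (by fun_prop)
        have e' : ∀ (r : ℝ) (u : R3 → ℝ≥0∞),
            ∫⁻ ξ : R3, (‖ξ‖ₑ ^ (r / 2) * u ξ) ^ 2 = energy r u := by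
          intro r u
          refine lintegral_congr fun ξ => ?_
          rw [mul_pow, sq_enorm_rpow]
          ring_nf
        rw [e', e'] at hcs
        have hle : ∫⁻ ξ, ‖P (τ, ξ)‖ₑ ≤
            ∫⁻ ξ, ‖ξ‖ₑ ^ (s / 2) * ‖N τ ξ‖ₑ * (‖ξ‖ₑ ^ (-s / 2) * ‖φ ξ‖ₑ) := by
          refine lintegral_mono_ae ?_
          filter_upwards [ae_ne_zero] with ξ hξ
          simp only [P, enorm_mul, hhle τ hτ]
          calc ‖φ ξ‖ₑ * (heatKernel (t - τ) ξ * ‖N τ ξ‖ₑ) ≤ ‖φ ξ‖ₑ * (1 * ‖N τ ξ‖ₑ) := by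
                gcongr
                exact heatKernel_le_one _ _
            _ = (‖ξ‖ₑ ^ (s / 2) * ‖ξ‖ₑ ^ (-s / 2)) * (‖N τ ξ‖ₑ * ‖φ ξ‖ₑ) := by
                rw [enorm_rpow_mul_rpow hξ, ← add_div, add_neg_cancel, zero_div,
                  ENNReal.rpow_zero, one_mul, one_mul, mul_comm]
            _ = _ := by ring
        refine hle.trans (le_trans ?_ (add_le_add_right hcs 1))
        generalize (∫⁻ ξ, ‖ξ‖ₑ ^ (s / 2) * ‖N τ ξ‖ₑ * (‖ξ‖ₑ ^ (-s / 2) * ‖φ ξ‖ₑ)) = X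
        rcases le_total X 1 with hX | hX
        · exact hX.trans le_self_add
        · exact (le_self_pow₀ hX (by norm_num)).trans le_add_self
      refine (setLIntegral_mono' measurableSet_Ioc hbound).trans_lt ?_
      have hE : energy (-s) (fun ξ => ‖φ ξ‖ₑ) < ∞ :=
        energy_schwartz_lt_top (by linarith) (by linarith) φ
      rw [lintegral_add_left measurable_const, lintegral_mul_const' _ _ hE.ne]
      refine ENNReal.add_lt_top.2 ⟨by simp, ENNReal.mul_lt_top (lt_of_le_of_lt ?_ hfin) hE⟩
      exact lintegral_mono_set Ioc_subset_Icc_self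
    have e1 : ∀ ξ, φ ξ * G ξ = ∫ τ in Ioc 0 t, P (τ, ξ) := fun ξ => by
      simp only [P, G, integral_const_mul]
    refine ⟨?_, ?_⟩
    · simp only [e1]
      exact hint.integral_prod_right
    · simp only [e1]
      rw [h φ, intervalIntegral.integral_of_le ht]
      exact integral_integral_swap (f := fun τ ξ => P (τ, ξ)) hint
  filter_upwards [hS.ae_eq hG] with ξ hξ
  rw [hξ]
  refine (enorm_integral_le_lintegral_enorm _).trans ?_
  rw [duhamel]
  refine le_trans (setLIntegral_mono' measurableSet_Ioc fun τ hτ => ?_)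
    (lintegral_mono_set Ioc_subset_Icc_self)
  rw [enorm_mul, hhle τ hτ]

/-! ### Energies of complex-valued functions -/

/-- The square of the weighted `L²` norm of a complex-valued function. -/
def cEnergy (s : ℝ) (f : R3 → ℂ) : ℝ≥0∞ := energy s (fun ξ => ‖f ξ‖ₑ)

theorem sq_eLpNorm_two (f : R3 → ℂ) : eLpNorm f 2 volume ^ 2 = ∫⁻ ξ, ‖f ξ‖ₑ ^ 2 := by
  rw [eLpNorm_eq_lintegral_rpow_enorm_toReal (by simp) (by simp), ← ENNReal.rpow_natCast,
    ← ENNReal.rpow_mul]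
  simp

theorem cEnergy_eq_sq_eLpNorm (s : ℝ) (f : R3 → ℂ) :
    cEnergy s f = eLpNorm (fun ξ : R3 => ((‖ξ‖ ^ (s / 2) : ℝ) : ℂ) * f ξ) 2 volume ^ 2 := by
  rw [sq_eLpNorm_two]
  refine lintegral_congr_ae ?_
  filter_upwards [ae_ne_zero] with ξ hξ
  have hpos : 0 < ‖ξ‖ := norm_pos_iff.2 hξ
  have h : ‖((‖ξ‖ ^ (s / 2) : ℝ) : ℂ)‖ₑ = ‖ξ‖ₑ ^ (s / 2) := by
    rw [← ofReal_norm, ← ofReal_norm, Complex.norm_real, Real.norm_of_nonneg (by positivity),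
      ENNReal.ofReal_rpow_of_pos hpos]
  rw [enorm_mul, mul_pow, h, sq_enorm_rpow, mul_div_cancel₀ _ two_ne_zero]

/-- The `H^{1/2}` norm controls both `L²` (`s = 0`) and `Ḣ^{1/2}` (`s = 1`), since `|ξ|^s ≤ (1 +
|ξ|²)^{1/2}`. -/
theorem cEnergy_le_sq_eLpNorm_besselWeight {s : ℝ} (h0 : 0 ≤ s) (h1 : s ≤ 1) (f : R3 → ℂ) :
    cEnergy s f ≤
      eLpNorm (fun ξ : R3 => (((1 + ‖ξ‖ ^ 2) ^ ((1 / 2 : ℝ) / 2) : ℝ) : ℂ) * f ξ) 2 volume ^ 2 := by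
  rw [sq_eLpNorm_two]
  refine lintegral_mono fun ξ => ?_
  simp only [enorm_mul, mul_pow]
  gcongr
  rw [← ofReal_norm, ← ofReal_norm, ENNReal.ofReal_rpow_of_nonneg (norm_nonneg _) h0,
    Complex.norm_real, Real.norm_of_nonneg (by positivity), ← ENNReal.ofReal_pow (by positivity)]
  refine ENNReal.ofReal_le_ofReal ?_
  have e : ((1 + ‖ξ‖ ^ 2) ^ ((1 / 2 : ℝ) / 2)) ^ 2 = (1 + ‖ξ‖ ^ 2) ^ (1 / 2 : ℝ) := by
    rw [← Real.rpow_natCast, ← Real.rpow_mul (by positivity)]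
    norm_num
  rw [e]
  have hone : (1 : ℝ) ≤ 1 + ‖ξ‖ ^ 2 := by nlinarith [sq_nonneg ‖ξ‖]
  rcases le_total ‖ξ‖ 1 with h | h
  · exact (Real.rpow_le_one (norm_nonneg _) h h0).trans (Real.one_le_rpow hone (by norm_num))
  · calc ‖ξ‖ ^ s ≤ ‖ξ‖ ^ (1 : ℝ) := Real.rpow_le_rpow_of_exponent_le h h1
      _ = (‖ξ‖ ^ 2) ^ (1 / 2 : ℝ) := by
        rw [← Real.rpow_natCast, ← Real.rpow_mul (norm_nonneg _)]
        norm_num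
      _ ≤ _ := by
        gcongr
        linarith

theorem memLp_two_of_cEnergy_lt_top {f : R3 → ℂ} (hf : AEStronglyMeasurable f volume)
    (h : cEnergy 0 f < ∞) : MemLp f 2 volume := by
  refine ⟨hf, ?_⟩
  rw [cEnergy, energy_zero, ← sq_eLpNorm_two] at h
  exact (ENNReal.pow_lt_top_iff.1 h).resolve_right two_ne_zero

theorem measurable_cEnergy {V : ℝ → R3 → ℂ} (hV : Measurable (Function.uncurry V)) (s : ℝ) :
    Measurable fun t => cEnergy s (V t) :=
  (measurable_weighted_sq (n := fun t ξ => ‖V t ξ‖ₑ) hV.enorm s).lintegral_prod_right'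

theorem cEnergy_sub_le {s : ℝ} {f g : R3 → ℂ} (hf : Measurable f) :
    cEnergy s (fun ξ => f ξ - g ξ) ≤ 2 * (cEnergy s f + cEnergy s g) :=
  (energy_mono (ae_of_all _ fun _ => enorm_sub_le)).trans (energy_add_le hf.enorm)

theorem energy_sum_le {ι : Type*} (I : Finset ι) {s : ℝ} {f : ι → R3 → ℝ≥0∞}
    (hf : ∀ i ∈ I, Measurable (f i)) :
    energy s (fun ξ => ∑ i ∈ I, f i ξ) ≤ 2 ^ I.card * ∑ i ∈ I, energy s (f i) := by
  classical
  induction I using Finset.induction_on with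
  | empty => simp [energy]
  | insert a I ha ih =>
    simp only [Finset.sum_insert ha, Finset.card_insert_of_notMem ha]
    refine (energy_add_le (hf a (by simp))).trans ?_
    have h1 := ih fun i hi => hf i (by simp [hi])
    calc 2 * (energy s (f a) + energy s fun ξ => ∑ i ∈ I, f i ξ)
        ≤ 2 * (2 ^ I.card * energy s (f a) + 2 ^ I.card * ∑ i ∈ I, energy s (f i)) := by
          gcongr
          exact le_mul_of_one_le_left zero_le (one_le_pow₀ one_le_two)
      _ = _ := by ring

/-! ### Fourier transforms of solutions in the regularity classes -/

theorem MemLpTime.ae_le {T : ℝ} {N : Distr → ℝ≥0∞} {v : ℝ → Distr} (h : MemLpTime ∞ T N v) :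
    ∃ M : ℝ≥0∞, M ≠ ∞ ∧ ∀ᵐ t ∂(volume.restrict (Icc 0 T)), N (v t) ≤ M := by
  refine ⟨_, h.2.2.ne, ?_⟩
  rw [eLpNorm_exponent_top]
  exact ae_le_eLpNormEssSup (f := fun t => N (v t))

theorem MemLpTime.lintegral_sq_lt_top {T : ℝ} {N : Distr → ℝ≥0∞} {v : ℝ → Distr}
    (h : MemLpTime 2 T N v) : ∫⁻ t in Icc 0 T, N (v t) ^ 2 < ∞ := by
  have := h.2.2
  rw [eLpNorm_lt_top_iff_lintegral_rpow_enorm_lt_top (by simp) (by simp)] at this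
  simpa using this

theorem MemLpTime.ae_lt_top {T : ℝ} {N : Distr → ℝ≥0∞} {v : ℝ → Distr}
    (h : MemLpTime 2 T N v) : ∀ᵐ t ∂(volume.restrict (Icc 0 T)), N (v t) < ∞ := by
  filter_upwards [ae_lt_top' (h.2.1.pow_const 2) h.lintegral_sq_lt_top.ne] with t ht
  exact (ENNReal.pow_lt_top_iff.1 ht).resolve_right two_ne_zero

/-- `V` is the Fourier transform of the time-dependent distribution `v`, of class
`L^∞ Ḣ^{s/2} ∩ L² Ḣ^{s/2+1}`, and it is in `L²` at almost every time. -/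
structure IsFourierOf (T s : ℝ) (v : ℝ → Distr) (V : ℝ → R3 → ℂ) : Prop where
  measurable : Measurable (Function.uncurry V)
  represents : ∀ᵐ t ∂(volume.restrict (Icc 0 T)), Represents (𝓕 (v t)) (V t)
  memLp : ∀ᵐ t ∂(volume.restrict (Icc 0 T)), MemLp (V t) 2 volume
  bounded : ∃ M : ℝ≥0∞, M ≠ ∞ ∧ ∀ᵐ t ∂(volume.restrict (Icc 0 T)), cEnergy s (V t) ≤ M
  integrable : ∫⁻ t in Icc 0 T, cEnergy (s + 2) (V t) ≠ ∞

theorem exists_isFourierOf_velocity {T : ℝ} {v : ℝ → Distr}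
    (h : MemLpTime ∞ T (sobolevNorm (1 / 2)) v) (h' : MemLpTime 2 T (homSobolevNorm (3 / 2)) v) :
    ∃ V, IsFourierOf T 1 v V := by
  obtain ⟨M, hM, hbd⟩ := h.ae_le
  obtain ⟨V, hV, hrep⟩ := exists_measurable_represents (v := fun t => 𝓕 (v t))
    (μ := volume.restrict (Icc 0 T)) (fun φ => h.1 (𝓕 φ)) (by
      filter_upwards [hbd] with t ht
      obtain ⟨g, hg, -⟩ := exists_represents_of_sobolevNorm_lt_top (ht.trans_lt hM.lt_top)
      exact ⟨g, hg⟩)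
  have hle : ∀ s : ℝ, 0 ≤ s → s ≤ 1 → ∀ᵐ t ∂(volume.restrict (Icc 0 T)),
      cEnergy s (V t) ≤ M ^ 2 := by
    intro s hs0 hs1
    filter_upwards [hbd, hrep] with t ht hr
    refine (cEnergy_le_sq_eLpNorm_besselWeight hs0 hs1 _).trans ?_
    rw [← sobolevNorm_eq hr (ht.trans_lt hM.lt_top)]
    gcongr
  refine ⟨V, hV, hrep, ?_, ⟨M ^ 2, ENNReal.pow_ne_top hM, hle 1 zero_le_one le_rfl⟩, ?_⟩
  · filter_upwards [hle 0 le_rfl zero_le_one, hrep] with t ht hr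
    exact memLp_two_of_cEnergy_lt_top hr.aestronglyMeasurable
      (ht.trans_lt (ENNReal.pow_lt_top hM.lt_top))
  · refine (lt_of_eq_of_lt (lintegral_congr_ae ?_) h'.lintegral_sq_lt_top).ne
    filter_upwards [hrep] with t hr
    rw [homSobolevNorm_eq _ hr, cEnergy_eq_sq_eLpNorm]
    norm_num

theorem exists_isFourierOf_temperature {T : ℝ} {v : ℝ → Distr}
    (h : MemLpTime ∞ T (homSobolevNorm (-1 / 2)) v)
    (h' : MemLpTime 2 T (homSobolevNorm (1 / 2)) v) : ∃ V, IsFourierOf T (-1) v V := by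
  obtain ⟨M, hM, hbd⟩ := h.ae_le
  obtain ⟨V, hV, hrep⟩ := exists_measurable_represents (v := fun t => 𝓕 (v t))
    (μ := volume.restrict (Icc 0 T)) (fun φ => h.1 (𝓕 φ)) (by
      filter_upwards [hbd] with t ht
      exact exists_represents_of_homSobolevNorm_lt_top (ht.trans_lt hM.lt_top))
  have hle : ∀ᵐ t ∂(volume.restrict (Icc 0 T)), cEnergy (-1) (V t) ≤ M ^ 2 := by
    filter_upwards [hbd, hrep] with t ht hr
    rw [cEnergy_eq_sq_eLpNorm, ← homSobolevNorm_eq _ hr]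
    gcongr
  refine ⟨V, hV, hrep, ?_, ⟨M ^ 2, ENNReal.pow_ne_top hM, hle⟩, ?_⟩
  · filter_upwards [hle, hrep, h'.ae_lt_top] with t ht hr hlt
    refine memLp_two_of_cEnergy_lt_top hr.aestronglyMeasurable ?_
    have hVt : Measurable (V t) := hV.comp measurable_prodMk_left
    -- `L²` lies halfway between `Ḣ^{-1/2}` and `Ḣ^{1/2}`. Square integrability of the temperature
    -- is what gives a meaning to its product with the velocity.
    have hint := sq_energy_le (a := -1) (b := 0) (c := 1) (by norm_num) hVt.enorm
    have h1 : cEnergy 1 (V t) < ∞ := by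
      rw [cEnergy_eq_sq_eLpNorm, ← homSobolevNorm_eq _ hr]
      exact ENNReal.pow_lt_top hlt
    have := hint.trans_lt (ENNReal.mul_lt_top (ht.trans_lt (ENNReal.pow_lt_top hM.lt_top)) h1)
    exact (ENNReal.pow_lt_top_iff.1 this).resolve_right two_ne_zero
  · refine (lt_of_eq_of_lt (lintegral_congr_ae ?_) h'.lintegral_sq_lt_top).ne
    filter_upwards [hrep] with t hr
    rw [homSobolevNorm_eq _ hr, cEnergy_eq_sq_eLpNorm]
    norm_num

/-! ### Estimates for the nonlinear terms -/

/-- Bilinearity: `V * g - V' * g' = (V - V') * g + V' * (g - g')`. The constant `8` bounds `2π`. -/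
theorem enorm_advSymbol_sub_le {V V' : Fin 3 → R3 → ℂ} {g g' : R3 → ℂ}
    (hV : ∀ j, MemLp (V j) 2 volume) (hV' : ∀ j, MemLp (V' j) 2 volume) (hg : MemLp g 2 volume)
    (hg' : MemLp g' 2 volume) (ξ : R3) :
    ‖advSymbol V g ξ - advSymbol V' g' ξ‖ₑ ≤ 8 * (‖ξ‖ₑ ^ (1 : ℝ) * ∑ j : Fin 3,
      (econv (fun ξ => ‖V j ξ - V' j ξ‖ₑ) (fun ξ => ‖g ξ‖ₑ) ξ +
        econv (fun ξ => ‖V' j ξ‖ₑ) (fun ξ => ‖g ξ - g' ξ‖ₑ) ξ)) := by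
  have h2π : ‖(2 * Real.pi * Complex.I : ℂ)‖ₑ ≤ 8 := by
    rw [← ofReal_norm, norm_mul, norm_mul, Complex.norm_I, Complex.norm_real, Complex.norm_ofNat,
      Real.norm_of_nonneg Real.pi_pos.le, mul_one]
    refine (ENNReal.ofReal_le_ofReal (by linarith [Real.pi_le_four] :
      2 * Real.pi ≤ (8 : ℝ))).trans ?_
    simp
  have hcoord : ∀ j : Fin 3, ‖((ξ j : ℝ) : ℂ)‖ₑ ≤ ‖ξ‖ₑ := by
    intro j
    rw [← ofReal_norm, ← ofReal_norm, Complex.norm_real]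
    exact ENNReal.ofReal_le_ofReal (abs_coord_le_norm ξ j)
  rw [advSymbol, advSymbol, ← Finset.sum_sub_distrib, ← mul_assoc, Finset.mul_sum]
  refine (enorm_sum_le _ _).trans (Finset.sum_le_sum fun j _ => ?_)
  have e : (2 * Real.pi * Complex.I : ℂ) * ((ξ j : ℝ) * conv (V j) g ξ) -
      (2 * Real.pi * Complex.I : ℂ) * ((ξ j : ℝ) * conv (V' j) g' ξ) =
      (2 * Real.pi * Complex.I : ℂ) * ((ξ j : ℝ) * (conv (fun ξ => V j ξ - V' j ξ) g ξ +
        conv (V' j) (fun ξ => g ξ - g' ξ) ξ)) := by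
    rw [conv_sub_left (hV j) (hV' j) hg, conv_sub_right (hV' j) hg hg']
    ring
  rw [e, enorm_mul (2 * Real.pi * Complex.I : ℂ), enorm_mul (((ξ j : ℝ) : ℂ)), ENNReal.rpow_one,
    mul_assoc (8 : ℝ≥0∞)]
  exact mul_le_mul' h2π (mul_le_mul' (hcoord j) ((enorm_add_le _ _).trans
    (add_le_add (enorm_conv_le_econv _ _ _) (enorm_conv_le_econv _ _ _))))

/-- A common form of the estimates for the advection term in `Ḣ^{-1/2}` and `Ḣ^{-3/2}`. -/
theorem exists_cEnergy_advSymbol_sub_le {s α β : ℝ} {C : ℝ≥0∞} (hC : C ≠ ∞)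
    (h : ∀ f g : R3 → ℝ≥0∞, Measurable f → Measurable g →
      energy (s + 2) (econv f g) ≤ C * (energy α f * energy β g)) :
    ∃ K : ℝ≥0∞, K ≠ ∞ ∧ ∀ (V V' : Fin 3 → R3 → ℂ) (g g' : R3 → ℂ),
      (∀ j, Measurable (V j)) → (∀ j, Measurable (V' j)) → Measurable g → Measurable g' →
      (∀ j, MemLp (V j) 2 volume) → (∀ j, MemLp (V' j) 2 volume) → MemLp g 2 volume →
      MemLp g' 2 volume →
      cEnergy s (fun ξ => advSymbol V g ξ - advSymbol V' g' ξ) ≤ K * ∑ j : Fin 3,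
        (cEnergy α (fun ξ => V j ξ - V' j ξ) * cEnergy β g +
          cEnergy α (V' j) * cEnergy β (fun ξ => g ξ - g' ξ)) := by
  -- The factors come from squaring the pointwise constant `8`, from the sum over three indices, and
  -- from the two bilinear terms.
  refine ⟨8 ^ 2 * (2 ^ 3 * (2 * C)), by finiteness, ?_⟩
  intro V V' g g' mV mV' mg mg' hV hV' hg hg'
  have m1 : ∀ j, Measurable (econv (fun ξ => ‖V j ξ - V' j ξ‖ₑ) (fun ξ => ‖g ξ‖ₑ)) := fun j =>
    measurable_econv ((mV j).sub (mV' j)).enorm mg.enorm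
  have m2 : ∀ j, Measurable (econv (fun ξ => ‖V' j ξ‖ₑ) (fun ξ => ‖g ξ - g' ξ‖ₑ)) := fun j =>
    measurable_econv (mV' j).enorm (mg.sub mg').enorm
  refine (energy_mono (ae_of_all _ (enorm_advSymbol_sub_le hV hV' hg hg'))).trans ?_
  rw [energy_const_mul (by fun_prop), energy_enorm_rpow_mul, mul_one, mul_assoc]
  gcongr
  refine (energy_sum_le _ fun j _ => (m1 j).add (m2 j)).trans ?_
  rw [Finset.card_univ, Fintype.card_fin, mul_assoc (2 ^ 3)]
  gcongr
  rw [Finset.mul_sum]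
  refine Finset.sum_le_sum fun j _ => ?_
  calc _ ≤ _ := energy_add_le (m1 j)
    _ ≤ 2 * (C * (cEnergy α (fun ξ => V j ξ - V' j ξ) * cEnergy β g) +
        C * (cEnergy α (V' j) * cEnergy β (fun ξ => g ξ - g' ξ))) := by
      gcongr
      · exact h _ _ ((mV j).sub (mV' j)).enorm mg.enorm
      · exact h _ _ (mV' j).enorm (mg.sub mg').enorm
    _ = _ := by ring

/-- The Fourier transform of the forcing term in the equation of the velocity. -/
def velocityForcing (V : Fin 3 → R3 → ℂ) (g : R3 → ℂ) (i : Fin 3) (ξ : R3) : ℂ :=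
  -(∑ k : Fin 3, (leraySymbol i k ξ : ℂ) * advSymbol V (V k) ξ) + (leraySymbol i 2 ξ : ℂ) * g ξ

theorem enorm_leraySymbol_le (i k : Fin 3) (ξ : R3) : ‖(leraySymbol i k ξ : ℂ)‖ₑ ≤ 2 := by
  rw [← ofReal_norm, Complex.norm_real]
  exact (ENNReal.ofReal_le_ofReal (abs_leraySymbol_le i k ξ)).trans (by simp)

theorem enorm_velocityForcing_sub_le (V V' : Fin 3 → R3 → ℂ) (g g' : R3 → ℂ) (i : Fin 3) (ξ : R3) :
    ‖velocityForcing V g i ξ - velocityForcing V' g' i ξ‖ₑ ≤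
      2 * ((∑ k : Fin 3, ‖advSymbol V (V k) ξ - advSymbol V' (V' k) ξ‖ₑ) + ‖g ξ - g' ξ‖ₑ) := by
  have e : velocityForcing V g i ξ - velocityForcing V' g' i ξ =
      (leraySymbol i 2 ξ : ℂ) * (g ξ - g' ξ) - ∑ k : Fin 3, (leraySymbol i k ξ : ℂ) *
        (advSymbol V (V k) ξ - advSymbol V' (V' k) ξ) := by
    simp only [velocityForcing, mul_sub, Finset.sum_sub_distrib]
    ring
  rw [e, mul_add, add_comm, Finset.mul_sum]
  refine enorm_sub_le.trans (add_le_add ?_ ((enorm_sum_le _ _).trans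
    (Finset.sum_le_sum fun k _ => ?_)))
  all_goals
    rw [enorm_mul]
    gcongr
    exact enorm_leraySymbol_le _ _ _

theorem measurable_advSymbol {α : Type*} [MeasurableSpace α] {V : α → Fin 3 → R3 → ℂ}
    {g : α → R3 → ℂ} (hV : ∀ j, Measurable (fun p : α × R3 => V p.1 j p.2))
    (hg : Measurable (Function.uncurry g)) :
    Measurable (fun p : α × R3 => advSymbol (V p.1) (g p.1) p.2) := by
  refine Finset.measurable_sum _ fun j _ => Measurable.const_mul (Measurable.mul ?_ ?_) _
  · have : Measurable fun p : α × R3 => p.2 j := by fun_prop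
    exact Complex.measurable_ofReal.comp this
  · exact measurable_conv (f := fun a => V a j) (hV j) hg

theorem measurable_velocityForcing {α : Type*} [MeasurableSpace α] {V : α → Fin 3 → R3 → ℂ}
    {g : α → R3 → ℂ} (hV : ∀ j, Measurable (fun p : α × R3 => V p.1 j p.2))
    (hg : Measurable (Function.uncurry g)) (i : Fin 3) :
    Measurable (fun p : α × R3 => velocityForcing (V p.1) (g p.1) i p.2) := by
  have hl : ∀ k, Measurable fun p : α × R3 => (leraySymbol i k p.2 : ℂ) := fun k =>
    Complex.measurable_ofReal.comp ((measurable_leraySymbol i k).comp measurable_snd)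
  refine Measurable.add (Measurable.neg (Finset.measurable_sum _ fun k _ => (hl k).mul ?_))
    ((hl 2).mul hg)
  exact measurable_advSymbol (g := fun a => V a k) hV (hV k)

/-! ### Differences of representatives and of regular fields -/

theorem Represents.neg {T : Distr} {g : R3 → ℂ} (hT : Represents T g) :
    Represents (-T) (fun x => -g x) := by
  intro φ
  have e : (-T) φ = -(T φ) := rfl
  simp only [mul_neg]
  exact ⟨(hT φ).1.neg, by rw [e, (hT φ).2, integral_neg]⟩

theorem Represents.sub {S T : Distr} {f g : R3 → ℂ} (hS : Represents S f) (hT : Represents T g) :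
    Represents (S - T) (fun x => f x - g x) := by
  simpa only [sub_eq_add_neg] using hS.add hT.neg

theorem fourier_sub (S T : Distr) : 𝓕 (S - T) = 𝓕 S - 𝓕 T := map_sub (fourierCLM ℂ Distr) S T

theorem fourier_neg (T : Distr) : 𝓕 (-T) = -𝓕 T := map_neg (fourierCLM ℂ Distr) T

theorem fourier_add' (S T : Distr) : 𝓕 (S + T) = 𝓕 S + 𝓕 T := map_add (fourierCLM ℂ Distr) S T

namespace IsFourierOf

variable {T s : ℝ} {v v' : ℝ → Distr} {V V' : ℝ → R3 → ℂ}

theorem measurable_slice (h : IsFourierOf T s v V) (t : ℝ) : Measurable (V t) :=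
  h.measurable.comp measurable_prodMk_left

theorem sub (h : IsFourierOf T s v V) (h' : IsFourierOf T s v' V') :
    IsFourierOf T s (fun t => v t - v' t) (fun t ξ => V t ξ - V' t ξ) := by
  refine ⟨h.measurable.sub h'.measurable, ?_, ?_, ?_, ?_⟩
  · filter_upwards [h.represents, h'.represents] with t h1 h2
    rw [fourier_sub]
    exact h1.sub h2
  · filter_upwards [h.memLp, h'.memLp] with t h1 h2
    exact h1.sub h2
  · obtain ⟨M, hM, hb⟩ := h.bounded
    obtain ⟨M', hM', hb'⟩ := h'.bounded
    refine ⟨2 * (M + M'), by finiteness, ?_⟩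
    filter_upwards [hb, hb'] with t h1 h2
    exact (cEnergy_sub_le (h.measurable_slice t)).trans (by gcongr)
  · refine ne_top_of_le_ne_top ?_
      (lintegral_mono fun t => cEnergy_sub_le (g := V' t) (h.measurable_slice t))
    rw [lintegral_const_mul' _ _ (by simp), lintegral_add_left (measurable_cEnergy h.measurable _)]
    exact ENNReal.mul_ne_top (by simp) (ENNReal.add_ne_top.2 ⟨h.integrable, h'.integrable⟩)

/-- Interpolation between the uniform bound and the time-integrated one: for example `L^∞ Ḣ^{1/2} ∩
L² Ḣ^{3/2} ⊂ L⁴ Ḣ¹`. This supplies the integrable weight for Gronwall. -/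
theorem lintegral_sq_ne_top (h : IsFourierOf T s v V) {r : ℝ} (hr : r = s + 1) :
    ∫⁻ t in Icc 0 T, cEnergy r (V t) ^ 2 ≠ ∞ := by
  obtain ⟨M, hM, hb⟩ := h.bounded
  refine ne_top_of_le_ne_top (b := M * ∫⁻ t in Icc 0 T, cEnergy (s + 2) (V t))
    (ENNReal.mul_ne_top hM h.integrable) ?_
  rw [← lintegral_const_mul' _ _ hM]
  refine lintegral_mono_ae ?_
  filter_upwards [hb] with t ht
  refine (sq_energy_le (a := s) (c := s + 2) (by linarith) (h.measurable_slice t).enorm).trans ?_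
  exact mul_le_mul' ht le_rfl

end IsFourierOf

/-! ### The difference of two mild solutions -/

theorem integral_heat_eq {T t : ℝ} (htT : t ≤ T) {F : ℝ → Distr} {G : ℝ → R3 → ℂ}
    (hF : ∀ᵐ τ ∂(volume.restrict (Icc 0 T)), Represents (𝓕 (F τ)) (G τ)) (φ : 𝓢(R3, ℂ)) :
    ∀ᵐ τ ∂(volume.restrict (Ioc 0 t)),
      Integrable (fun ξ => φ ξ * ((heatSymbol (t - τ) ξ : ℂ) * G τ ξ)) ∧
      heat (t - τ) (F τ) (𝓕 φ) = ∫ ξ, φ ξ * ((heatSymbol (t - τ) ξ : ℂ) * G τ ξ) := by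
  have hsub : Ioc 0 t ⊆ Icc 0 T := fun x hx => ⟨hx.1.le, hx.2.trans htT⟩
  filter_upwards [ae_restrict_of_ae_restrict_of_subset hsub hF, ae_restrict_mem measurableSet_Ioc]
    with τ hτ hmem
  exact represents_fourier_heat hτ (sub_nonneg.2 hmem.2) φ

/-- The common term `c`, the free evolution of the data, cancels in the difference. Testing the mild
formulas against `𝓕 φ` moves them to the Fourier side. -/
theorem ae_enorm_sub_le_duhamel {T s : ℝ} {v v' F F' c : ℝ → Distr} {V V' G G' : ℝ → R3 → ℂ}
    (hV : ∀ᵐ t ∂(volume.restrict (Icc 0 T)), Represents (𝓕 (v t)) (V t))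
    (hV' : ∀ᵐ t ∂(volume.restrict (Icc 0 T)), Represents (𝓕 (v' t)) (V' t))
    (hF : ∀ᵐ t ∂(volume.restrict (Icc 0 T)), Represents (𝓕 (F t)) (G t))
    (hF' : ∀ᵐ t ∂(volume.restrict (Icc 0 T)), Represents (𝓕 (F' t)) (G' t))
    (hG : Measurable (Function.uncurry G)) (hG' : Measurable (Function.uncurry G'))
    (hs : s ≤ 0) (hs' : -4 ≤ s)
    (hfin : ∫⁻ τ in Icc 0 T, cEnergy s (fun ξ => G τ ξ - G' τ ξ) ≠ ∞)
    (hm : ∀ᵐ t ∂(volume.restrict (Icc 0 T)), ∀ φ : 𝓢(R3, ℂ),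
      IntervalIntegrable (fun τ => heat (t - τ) (F τ) φ) volume 0 t ∧
      v t φ = c t φ + ∫ τ in 0..t, heat (t - τ) (F τ) φ)
    (hm' : ∀ᵐ t ∂(volume.restrict (Icc 0 T)), ∀ φ : 𝓢(R3, ℂ),
      IntervalIntegrable (fun τ => heat (t - τ) (F' τ) φ) volume 0 t ∧
      v' t φ = c t φ + ∫ τ in 0..t, heat (t - τ) (F' τ) φ) :
    ∀ᵐ t ∂(volume.restrict (Icc 0 T)), ∀ᵐ ξ,
      ‖V t ξ - V' t ξ‖ₑ ≤ duhamel (fun τ ξ => ‖G τ ξ - G' τ ξ‖ₑ) t ξ := by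
  filter_upwards [hV, hV', hm, hm', ae_restrict_mem measurableSet_Icc] with t h1 h2 h3 h4 ht
  refine ae_enorm_le_duhamel (N := fun τ ξ => G τ ξ - G' τ ξ) (h1.sub h2) (hG.sub hG') ht.1 hs hs'
    (lt_of_le_of_lt (lintegral_mono_set (Icc_subset_Icc_right ht.2)) hfin.lt_top) fun φ => ?_
  obtain ⟨i1, e1⟩ := h3 (𝓕 φ)
  obtain ⟨i2, e2⟩ := h4 (𝓕 φ)
  have e : (𝓕 (v t) - 𝓕 (v' t)) φ = v t (𝓕 φ) - v' t (𝓕 φ) := rfl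
  rw [e, e1, e2, add_sub_add_left_eq_sub, ← intervalIntegral.integral_sub i1 i2,
    intervalIntegral.integral_of_le ht.1, intervalIntegral.integral_of_le ht.1]
  refine integral_congr_ae ?_
  filter_upwards [integral_heat_eq ht.2 hF φ, integral_heat_eq ht.2 hF' φ] with τ h5 h6
  rw [h5.2, h6.2, ← integral_sub h5.1 h6.1]
  refine integral_congr_ae (ae_of_all _ fun ξ => ?_)
  simp only
  ring

theorem IsMildSolution.velocity_eq {T₀ : ℝ} {u₀ : Fin 3 → Distr} {θ₀ : Distr}
    {u : ℝ → Fin 3 → Distr} {θ : ℝ → Distr} (h : IsMildSolution T₀ u₀ θ₀ u θ) (i : Fin 3) :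
    ∀ᵐ t ∂(volume.restrict (Icc 0 T₀)), ∀ φ : 𝓢(R3, ℂ),
      IntervalIntegrable (fun τ => heat (t - τ) (-leray (fun k => advection (u τ) (u τ k)) i +
        leray (buoyancy (θ τ)) i) φ) volume 0 t ∧
      u t i φ = heat t (u₀ i) φ + ∫ τ in 0..t,
        heat (t - τ) (-leray (fun k => advection (u τ) (u τ k)) i + leray (buoyancy (θ τ)) i) φ := by
  filter_upwards [h.velocity] with t ht φ
  obtain ⟨i1, i2, e⟩ := ht i φ
  have e' : ∀ τ, heat (t - τ) (-leray (fun k => advection (u τ) (u τ k)) i +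
      leray (buoyancy (θ τ)) i) φ = -heat (t - τ) (leray (fun k => advection (u τ) (u τ k)) i) φ +
      heat (t - τ) (leray (buoyancy (θ τ)) i) φ := by
    intro τ
    rw [map_add, map_neg]
    rfl
  simp only [e']
  refine ⟨i1.neg.add i2, ?_⟩
  have hi : IntervalIntegrable (fun τ =>
      -heat (t - τ) (leray (fun k => advection (u τ) (u τ k)) i) φ) volume 0 t := i1.neg
  rw [intervalIntegral.integral_add hi i2, intervalIntegral.integral_neg, e]
  ring

theorem IsMildSolution.temperature_eq {T₀ : ℝ} {u₀ : Fin 3 → Distr} {θ₀ : Distr}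
    {u : ℝ → Fin 3 → Distr} {θ : ℝ → Distr} (h : IsMildSolution T₀ u₀ θ₀ u θ) :
    ∀ᵐ t ∂(volume.restrict (Icc 0 T₀)), ∀ φ : 𝓢(R3, ℂ),
      IntervalIntegrable (fun τ => heat (t - τ) (-advection (u τ) (θ τ)) φ) volume 0 t ∧
      θ t φ = heat t θ₀ φ + ∫ τ in 0..t, heat (t - τ) (-advection (u τ) (θ τ)) φ := by
  filter_upwards [h.temperature] with t ht φ
  obtain ⟨i1, e⟩ := ht φ
  have e' : ∀ τ, heat (t - τ) (-advection (u τ) (θ τ)) φ =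
      -heat (t - τ) (advection (u τ) (θ τ)) φ := by
    intro τ
    rw [map_neg]
    rfl
  simp only [e']
  refine ⟨i1.neg, ?_⟩
  rw [intervalIntegral.integral_neg, e]
  ring

/-! ### The closing argument -/

theorem two_mul_le_of_sq_le {x y z : ℝ≥0∞} (h : x ^ 2 ≤ y * z) : 2 * x ≤ y + z := by
  rcases eq_or_ne y ∞ with rfl | hy
  · simp
  rcases eq_or_ne z ∞ with rfl | hz
  · simp
  have hx : x ≠ ∞ := by
    rintro rfl
    exact (ENNReal.mul_lt_top hy.lt_top hz.lt_top).ne (top_le_iff.1 (by simpa using h))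
  lift x to NNReal using hx
  lift y to NNReal using hy
  lift z to NNReal using hz
  norm_cast at h ⊢
  have h' : (x : ℝ) ^ 2 ≤ y * z := by exact_mod_cast h
  have : 2 * (x : ℝ) ≤ y + z :=
    abs_le_of_sq_le_sq' (by nlinarith [sq_nonneg ((y : ℝ) - z)]) (by positivity) |>.2
  exact_mod_cast this

theorem mul_le_sq_add_sq (x y : ℝ≥0∞) : x * y ≤ x ^ 2 + y ^ 2 := by
  have : (x * y) ^ 2 ≤ x ^ 2 * y ^ 2 := (mul_pow x y 2).le
  refine le_trans ?_ (two_mul_le_of_sq_le this)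
  exact le_mul_of_one_le_left zero_le one_le_two

theorem lintegral_sq_add_ne_top {α : Type*} [MeasurableSpace α] {μ : Measure α} {f g : α → ℝ≥0∞}
    (hf : Measurable f) (h1 : ∫⁻ x, f x ^ 2 ∂μ ≠ ∞) (h2 : ∫⁻ x, g x ^ 2 ∂μ ≠ ∞) :
    ∫⁻ x, (f x + g x) ^ 2 ∂μ ≠ ∞ := by
  refine ne_top_of_le_ne_top ?_ (lintegral_mono fun x => sq_add_le (f x) (g x))
  rw [lintegral_const_mul' _ _ (by simp), lintegral_add_left (by fun_prop)]
  exact ENNReal.mul_ne_top (by simp) (ENNReal.add_ne_top.2 ⟨h1, h2⟩)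

theorem lintegral_sq_sum_ne_top {α ι : Type*} [MeasurableSpace α] {μ : Measure α} (I : Finset ι)
    {f : ι → α → ℝ≥0∞} (hf : ∀ i, Measurable (f i)) (h : ∀ i, ∫⁻ x, f i x ^ 2 ∂μ ≠ ∞) :
    ∫⁻ x, (∑ i ∈ I, f i x) ^ 2 ∂μ ≠ ∞ := by
  classical
  induction I using Finset.induction_on with
  | empty => simp
  | insert a I ha ih =>
    simp only [Finset.sum_insert ha]
    exact lintegral_sq_add_ne_top (hf a) (h a) ih

/-- Since `P ≤ 4 √(E D)`, Young's inequality gives `2 K P a ≤ D + 16 K² a² E`. Half of the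
dissipation on the left absorbs `D`, and the rest is Gronwall with weight `b`. -/
theorem ae_eq_zero_of_energy_inequality {T : ℝ} {E D P a : ℝ → ℝ≥0∞} {K M : ℝ≥0∞} (hK : K ≠ ∞)
    (hM : M ≠ ∞) (hDm : Measurable D) (ha : ∫⁻ t in Icc 0 T, a t ^ 2 ≠ ∞)
    (hD : ∫⁻ t in Icc 0 T, D t ≠ ∞) (hE : ∀ᵐ t ∂(volume.restrict (Icc 0 T)), E t ≤ M)
    (hP : ∀ᵐ t ∂(volume.restrict (Icc 0 T)), P t ^ 2 ≤ 16 * (E t * D t))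
    (h : ∀ᵐ t ∂(volume.restrict (Icc 0 T)), E t + ∫⁻ τ in Icc 0 t, D τ ≤
      ∫⁻ τ in Icc 0 t, K * (P τ * a τ + E τ)) :
    ∀ᵐ t ∂(volume.restrict (Icc 0 T)), E t = 0 := by
  let b : ℝ → ℝ≥0∞ := fun t => 16 * K ^ 2 * a t ^ 2 + 2 * K
  have hb : ∫⁻ t in Icc 0 T, b t ≠ ∞ := by
    simp only [b]
    rw [lintegral_add_right _ measurable_const, lintegral_const_mul' _ _ (by finiteness)]
    refine ENNReal.add_ne_top.2 ⟨ENNReal.mul_ne_top (by finiteness) ha, ?_⟩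
    simp only [lintegral_const, MeasurableSet.univ, Measure.restrict_apply, univ_inter,
      Real.volume_Icc]
    finiteness
  have hbE : ∫⁻ t in Icc 0 T, b t * E t ≠ ∞ := by
    refine ne_top_of_le_ne_top (b := ∫⁻ t in Icc 0 T, b t * M) ?_ (lintegral_mono_ae ?_)
    · rw [lintegral_mul_const' _ _ hM]
      exact ENNReal.mul_ne_top hb hM
    · filter_upwards [hE] with t ht
      gcongr
  refine ae_eq_zero_of_le_lintegral hb hbE ?_
  filter_upwards [h, ae_restrict_mem measurableSet_Icc] with t ht htT
  have hsub : Icc 0 t ⊆ Icc 0 T := Icc_subset_Icc_right htT.2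
  set X := ∫⁻ τ in Icc 0 t, D τ
  have hX : X ≠ ∞ := ne_top_of_le_ne_top hD (lintegral_mono_set hsub)
  have key : 2 * ∫⁻ τ in Icc 0 t, K * (P τ * a τ + E τ) ≤ X + ∫⁻ τ in Icc 0 t, b τ * E τ := by
    rw [← lintegral_const_mul' _ _ (by simp), ← lintegral_add_left hDm]
    refine lintegral_mono_ae ?_
    filter_upwards [ae_restrict_of_ae_restrict_of_subset hsub hP] with τ hτ
    have h1 : (K * (P τ * a τ)) ^ 2 ≤ D τ * (16 * K ^ 2 * a τ ^ 2 * E τ) := by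
      calc (K * (P τ * a τ)) ^ 2 = K ^ 2 * a τ ^ 2 * P τ ^ 2 := by ring
        _ ≤ K ^ 2 * a τ ^ 2 * (16 * (E τ * D τ)) := by gcongr
        _ = _ := by ring
    calc 2 * (K * (P τ * a τ + E τ)) = 2 * (K * (P τ * a τ)) + 2 * K * E τ := by ring
      _ ≤ (D τ + 16 * K ^ 2 * a τ ^ 2 * E τ) + 2 * K * E τ := by
        gcongr
        exact two_mul_le_of_sq_le h1
      _ = _ := by simp only [b]; ring
  -- The doubled inequality is arranged so that one copy of `X` can be cancelled, which requires `X`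
  -- to be finite.
  have h2 : X + (X + 2 * E t) ≤ X + ∫⁻ τ in Icc 0 t, b τ * E τ := by
    calc X + (X + 2 * E t) = 2 * (E t + X) := by ring
      _ ≤ _ := (mul_le_mul_right ht 2).trans key
  calc E t ≤ X + 2 * E t := by
        refine le_trans ?_ le_add_self
        exact le_mul_of_one_le_left zero_le one_le_two
    _ ≤ _ := (ENNReal.add_le_add_iff_left hX).1 h2

theorem measurable_slice_sub {F G : ℝ → R3 → ℂ} (hF : Measurable (Function.uncurry F))
    (hG : Measurable (Function.uncurry G)) :
    Measurable (Function.uncurry fun τ ξ => ‖F τ ξ - G τ ξ‖ₑ) :=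
  (hF.sub hG).enorm

/-- The parabolic energy estimate for the difference of two solutions of heat equations with the
same initial data, on the Fourier side. -/
theorem ae_cEnergy_sub_add_lintegral_le {T s : ℝ} {v v' F F' c : ℝ → Distr}
    {V V' G G' : ℝ → R3 → ℂ}
    (hV : ∀ᵐ t ∂(volume.restrict (Icc 0 T)), Represents (𝓕 (v t)) (V t))
    (hV' : ∀ᵐ t ∂(volume.restrict (Icc 0 T)), Represents (𝓕 (v' t)) (V' t))
    (hF : ∀ᵐ t ∂(volume.restrict (Icc 0 T)), Represents (𝓕 (F t)) (G t))
    (hF' : ∀ᵐ t ∂(volume.restrict (Icc 0 T)), Represents (𝓕 (F' t)) (G' t))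
    (hG : Measurable (Function.uncurry G)) (hG' : Measurable (Function.uncurry G'))
    (hs : s ≤ 2) (hs' : -2 ≤ s)
    (hfin : ∫⁻ τ in Icc 0 T, cEnergy (s - 2) (fun ξ => G τ ξ - G' τ ξ) ≠ ∞)
    (hm : ∀ᵐ t ∂(volume.restrict (Icc 0 T)), ∀ φ : 𝓢(R3, ℂ),
      IntervalIntegrable (fun τ => heat (t - τ) (F τ) φ) volume 0 t ∧
      v t φ = c t φ + ∫ τ in 0..t, heat (t - τ) (F τ) φ)
    (hm' : ∀ᵐ t ∂(volume.restrict (Icc 0 T)), ∀ φ : 𝓢(R3, ℂ),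
      IntervalIntegrable (fun τ => heat (t - τ) (F' τ) φ) volume 0 t ∧
      v' t φ = c t φ + ∫ τ in 0..t, heat (t - τ) (F' τ) φ) :
    ∀ᵐ t ∂(volume.restrict (Icc 0 T)), cEnergy s (fun ξ => V t ξ - V' t ξ) +
      ∫⁻ τ in Icc 0 t, cEnergy (s + 2) (fun ξ => V τ ξ - V' τ ξ) ≤
      2 * ∫⁻ τ in Icc 0 t, cEnergy (s - 2) (fun ξ => G τ ξ - G' τ ξ) := by
  have hn := measurable_slice_sub hG hG'
  have h := ae_enorm_sub_le_duhamel hV hV' hF hF' hG hG' (by linarith) (by linarith) hfin hm hm'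
  filter_upwards [h, ae_restrict_mem measurableSet_Icc] with t ht htT
  rw [two_mul]
  refine add_le_add ((energy_mono ht).trans (energy_duhamel_le hn s t)) ?_
  have hsub : Icc 0 t ⊆ Icc 0 T := Icc_subset_Icc_right htT.2
  have h2 := lintegral_energy_duhamel_le hn (s + 2) t
  rw [show s + 2 - 4 = s - 2 by ring] at h2
  refine le_trans (lintegral_mono_ae ?_) h2
  filter_upwards [ae_restrict_of_ae_restrict_of_subset hsub h] with τ hτ
  exact energy_mono hτ

/-- Each bilinear term pairs a difference, controlled by `P`, with one of the solutions, controlled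
by `a`. Buoyancy is linear and contributes `E`. -/
theorem exists_forcing_le : ∃ K : ℝ≥0∞, K ≠ ∞ ∧ ∀ (V V' : Fin 3 → R3 → ℂ) (g g' : R3 → ℂ),
    (∀ j, Measurable (V j)) → (∀ j, Measurable (V' j)) → Measurable g → Measurable g' →
    (∀ j, MemLp (V j) 2 volume) → (∀ j, MemLp (V' j) 2 volume) → MemLp g 2 volume →
    MemLp g' 2 volume → ∀ P a E : ℝ≥0∞,
    (∀ j, cEnergy 2 (fun ξ => V j ξ - V' j ξ) ≤ P) → cEnergy 0 (fun ξ => g ξ - g' ξ) ≤ P →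
    (∀ j, cEnergy 2 (V j) ≤ a) → (∀ j, cEnergy 2 (V' j) ≤ a) → cEnergy 0 g ≤ a →
    cEnergy (-1) (fun ξ => g ξ - g' ξ) ≤ E →
    (∀ i, cEnergy (-1) (fun ξ => velocityForcing V g i ξ - velocityForcing V' g' i ξ) ≤
      K * (P * a + E)) ∧
    cEnergy (-3) (fun ξ => -advSymbol V g ξ - -advSymbol V' g' ξ) ≤ K * (P * a + E) := by
  obtain ⟨C₁, hC₁, h₁⟩ := exists_energy_one_econv_le
  obtain ⟨C₂, hC₂, h₂⟩ := exists_energy_econv_le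
  obtain ⟨K₁, hK₁, b₁⟩ := exists_cEnergy_advSymbol_sub_le (s := -1) (α := 2) (β := 2) hC₁
    (fun f g hf hg => by
      rw [show (-1 : ℝ) + 2 = 1 by norm_num]
      exact h₁ f g hf hg)
  -- Here the velocity is measured in `Ḣ¹` and the temperature in `L²`, so the factors are swapped
  -- to match the product law.
  obtain ⟨K₂, hK₂, b₂⟩ := exists_cEnergy_advSymbol_sub_le (s := -3) (α := 2) (β := 0) hC₂
    (fun f g hf hg => by
      rw [show (-3 : ℝ) + 2 = -1 by norm_num, econv_comm, mul_comm (energy 2 f)]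
      exact h₂ g f hg hf)
  -- The sum of the constants for the two equations. Each `6` counts two bilinear terms for three
  -- indices `j`; `2 ^ 3 * 3` comes from the sum over `k`, and `8 = 2² · 2` from the Leray symbol
  -- and from adding the buoyancy.
  refine ⟨8 * (2 ^ 3 * (3 * (K₁ * 6)) + 1) + K₂ * 6, by finiteness, ?_⟩
  intro V V' g g' mV mV' mg mg' lV lV' lg lg' P a E hP hP' ha ha' hg hE
  have hsum : ∀ x y z w : Fin 3 → ℝ≥0∞, (∀ j, x j ≤ P) → (∀ j, y j ≤ a) → (∀ j, z j ≤ a) →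
      (∀ j, w j ≤ P) → ∑ j, (x j * y j + z j * w j) ≤ 6 * (P * a) := by
    intro x y z w hx hy hz hw
    calc ∑ j, (x j * y j + z j * w j) ≤ ∑ _j : Fin 3, (P * a + a * P) :=
          Finset.sum_le_sum fun j _ => add_le_add (mul_le_mul' (hx j) (hy j))
            (mul_le_mul' (hz j) (hw j))
      _ = 6 * (P * a) := by
          rw [Finset.sum_const, Finset.card_univ, Fintype.card_fin, nsmul_eq_mul]
          push_cast
          ring
  have hadv : ∀ k, cEnergy (-1) (fun ξ => advSymbol V (V k) ξ - advSymbol V' (V' k) ξ) ≤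
      K₁ * 6 * (P * a) := by
    intro k
    refine (b₁ V V' (V k) (V' k) mV mV' (mV k) (mV' k) lV lV' (lV k) (lV' k)).trans ?_
    rw [mul_assoc]
    exact mul_le_mul_right (hsum _ _ _ _ hP (fun _ => ha k) ha' fun _ => hP k) _
  have madv : ∀ k, Measurable fun ξ => ‖advSymbol V (V k) ξ - advSymbol V' (V' k) ξ‖ₑ := by
    intro k
    have h1 := (measurable_advSymbol (α := Unit) (V := fun _ => V) (g := fun _ => V k)
      (fun j => (mV j).comp measurable_snd) ((mV k).comp measurable_snd)).comp
      (measurable_const (a := ()) |>.prodMk (measurable_id (α := R3)))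
    have h2 := (measurable_advSymbol (α := Unit) (V := fun _ => V') (g := fun _ => V' k)
      (fun j => (mV' j).comp measurable_snd) ((mV' k).comp measurable_snd)).comp
      (measurable_const (a := ()) |>.prodMk (measurable_id (α := R3)))
    exact (h1.sub h2).enorm
  have msum : Measurable fun ξ => ∑ k, ‖advSymbol V (V k) ξ - advSymbol V' (V' k) ξ‖ₑ :=
    Finset.measurable_sum _ fun k _ => madv k
  refine ⟨fun i => ?_, ?_⟩
  · refine (energy_mono (ae_of_all _ (enorm_velocityForcing_sub_le V V' g g' i))).trans ?_
    have mtot : Measurable fun ξ => (∑ k, ‖advSymbol V (V k) ξ - advSymbol V' (V' k) ξ‖ₑ) +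
        ‖g ξ - g' ξ‖ₑ := msum.add (mg.sub mg').enorm
    rw [energy_const_mul mtot]
    have h3 := (energy_sum_le (s := -1) Finset.univ fun k _ => madv k).trans
      (mul_le_mul_right (Finset.sum_le_sum fun k _ => hadv k) _)
    calc _ ≤ 2 ^ 2 * (2 * (2 ^ 3 * (3 * (K₁ * 6 * (P * a))) + E)) := by
          refine mul_le_mul_right ((energy_add_le msum).trans
            (mul_le_mul_right (add_le_add ?_ hE) _)) _
          simpa using h3
      -- The added terms are exactly what is missing from `K * (P * a + E)`, so that the last step
      -- is an identity.
      _ ≤ 2 ^ 2 * (2 * (2 ^ 3 * (3 * (K₁ * 6 * (P * a))) + E)) +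
          (K₂ * 6 * (P * a + E) + 8 * (P * a) + 8 * 2 ^ 3 * (3 * (K₁ * 6 * E))) := le_self_add
      _ = _ := by ring
  · have e : cEnergy (-3) (fun ξ => -advSymbol V g ξ - -advSymbol V' g' ξ) =
        cEnergy (-3) (fun ξ => advSymbol V g ξ - advSymbol V' g' ξ) := by
      simp only [cEnergy]
      congr 1
      ext ξ
      rw [← enorm_neg]
      congr 1
      ring
    rw [e]
    refine (b₂ V V' g g' mV mV' mg mg' lV lV' lg lg').trans ?_
    calc _ ≤ K₂ * (6 * (P * a)) :=
          mul_le_mul_right (hsum _ _ _ _ hP (fun _ => hg) ha' fun _ => hP') _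
      _ ≤ K₂ * (6 * (P * a)) +
          (K₂ * 6 * E + 8 * (2 ^ 3 * (3 * (K₁ * 6)) + 1) * (P * a + E)) := le_self_add
      _ = _ := by ring

theorem ae_eq_of_cEnergy_sub_eq_zero {s : ℝ} {f g : R3 → ℂ} (hf : Measurable f) (hg : Measurable g)
    (h : cEnergy s (fun ξ => f ξ - g ξ) = 0) : f =ᵐ[volume] g := by
  have hm : Measurable fun ξ => ‖f ξ - g ξ‖ₑ := (hf.sub hg).enorm
  rw [cEnergy, energy, lintegral_eq_zero_iff (by fun_prop)] at h
  filter_upwards [h, ae_ne_zero] with ξ h1 hξ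
  simp only [Pi.zero_apply, mul_eq_zero, ENNReal.rpow_eq_zero_iff, enorm_eq_zero, hξ, enorm_ne_top,
    false_and, or_false, false_or, pow_eq_zero_iff two_ne_zero, sub_eq_zero] at h1
  exact h1

theorem eq_of_fourier_represents {S T : Distr} {f g : R3 → ℂ} (hS : Represents (𝓕 S) f)
    (hT : Represents (𝓕 T) g) (h : f =ᵐ[volume] g) : S = T := by
  have e : 𝓕 S = 𝓕 T := (hS.congr_ae h).distr_eq hT
  rw [← fourierInv_fourier_eq (F := Distr) S, e, fourierInv_fourier_eq]

theorem represents_fourier_velocityForcing {T : ℝ} {u : ℝ → Fin 3 → Distr} {θ : ℝ → Distr}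
    {V : Fin 3 → ℝ → R3 → ℂ} {Θ : ℝ → R3 → ℂ} (hV : ∀ j, IsFourierOf T 1 (fun t => u t j) (V j))
    (hΘ : IsFourierOf T (-1) θ Θ) (i : Fin 3) :
    ∀ᵐ t ∂(volume.restrict (Icc 0 T)), Represents
      (𝓕 (-leray (fun k => advection (u t) (u t k)) i + leray (buoyancy (θ t)) i))
      (velocityForcing (fun j => V j t) (Θ t) i) := by
  filter_upwards [ae_all_iff.2 fun j => (hV j).represents, ae_all_iff.2 fun j => (hV j).memLp,
    hΘ.represents, hΘ.memLp] with t h1 h2 h3 h4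
  rw [fourier_add', fourier_neg]
  exact (represents_fourier_leray_advection h1 h2 i).neg.add
    (represents_fourier_leray_buoyancy h3 h4 i)

theorem represents_fourier_neg_advection {T : ℝ} {u : ℝ → Fin 3 → Distr} {θ : ℝ → Distr}
    {V : Fin 3 → ℝ → R3 → ℂ} {Θ : ℝ → R3 → ℂ} (hV : ∀ j, IsFourierOf T 1 (fun t => u t j) (V j))
    (hΘ : IsFourierOf T (-1) θ Θ) :
    ∀ᵐ t ∂(volume.restrict (Icc 0 T)), Represents (𝓕 (-advection (u t) (θ t)))
      (fun ξ => -advSymbol (fun j => V j t) (Θ t) ξ) := by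
  filter_upwards [ae_all_iff.2 fun j => (hV j).represents, ae_all_iff.2 fun j => (hV j).memLp,
    hΘ.represents, hΘ.memLp] with t h1 h2 h3 h4
  rw [fourier_neg]
  exact (represents_fourier_advection h1 h2 h3 h4).neg

theorem ae_eq_of_isFourierOf {T : ℝ} {u₀ : Fin 3 → Distr} {θ₀ : Distr}
    {u₁ u₂ : ℝ → Fin 3 → Distr} {θ₁ θ₂ : ℝ → Distr} (hsol₁ : IsMildSolution T u₀ θ₀ u₁ θ₁)
    (hsol₂ : IsMildSolution T u₀ θ₀ u₂ θ₂) {V₁ V₂ : Fin 3 → ℝ → R3 → ℂ} {Θ₁ Θ₂ : ℝ → R3 → ℂ}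
    (hV₁ : ∀ j, IsFourierOf T 1 (fun t => u₁ t j) (V₁ j))
    (hV₂ : ∀ j, IsFourierOf T 1 (fun t => u₂ t j) (V₂ j))
    (hΘ₁ : IsFourierOf T (-1) θ₁ Θ₁) (hΘ₂ : IsFourierOf T (-1) θ₂ Θ₂) :
    ∀ᵐ t ∂(volume.restrict (Icc 0 T)), u₁ t = u₂ t ∧ θ₁ t = θ₂ t := by
  have hw := fun j => (hV₁ j).sub (hV₂ j)
  have hη := hΘ₁.sub hΘ₂
  have mw : ∀ s j, Measurable fun t => cEnergy s (fun ξ => V₁ j t ξ - V₂ j t ξ) := fun s j =>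
    measurable_cEnergy (hw j).measurable s
  have mη : ∀ s, Measurable fun t => cEnergy s (fun ξ => Θ₁ t ξ - Θ₂ t ξ) := fun s =>
    measurable_cEnergy hη.measurable s
  -- In these quantities the temperature is always taken one derivative below the velocity, the
  -- offset dictated by buoyancy and the scaling.
  let E : ℝ → ℝ≥0∞ := fun t => (∑ j, cEnergy 1 (fun ξ => V₁ j t ξ - V₂ j t ξ)) +
    cEnergy (-1) (fun ξ => Θ₁ t ξ - Θ₂ t ξ)
  let D : ℝ → ℝ≥0∞ := fun t => (∑ j, cEnergy 3 (fun ξ => V₁ j t ξ - V₂ j t ξ)) +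
    cEnergy 1 (fun ξ => Θ₁ t ξ - Θ₂ t ξ)
  let P : ℝ → ℝ≥0∞ := fun t => (∑ j, cEnergy 2 (fun ξ => V₁ j t ξ - V₂ j t ξ)) +
    cEnergy 0 (fun ξ => Θ₁ t ξ - Θ₂ t ξ)
  let a : ℝ → ℝ≥0∞ := fun t => (∑ j, cEnergy 2 (V₁ j t)) + (∑ j, cEnergy 2 (V₂ j t)) +
    cEnergy 0 (Θ₁ t)
  have mE : Measurable E := (Finset.measurable_sum _ fun j _ => mw 1 j).add (mη (-1))
  have mD : Measurable D := (Finset.measurable_sum _ fun j _ => mw 3 j).add (mη 1)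
  have mP : Measurable P := (Finset.measurable_sum _ fun j _ => mw 2 j).add (mη 0)
  have m₁ : ∀ j, Measurable fun t => cEnergy 2 (V₁ j t) := fun j =>
    measurable_cEnergy (hV₁ j).measurable 2
  have m₂ : ∀ j, Measurable fun t => cEnergy 2 (V₂ j t) := fun j =>
    measurable_cEnergy (hV₂ j).measurable 2
  have ha : ∫⁻ t in Icc 0 T, a t ^ 2 ≠ ∞ := by
    refine lintegral_sq_add_ne_top ?_ (lintegral_sq_add_ne_top ?_ ?_ ?_)
      (hΘ₁.lintegral_sq_ne_top (by norm_num))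
    · exact (Finset.measurable_sum _ fun j _ => m₁ j).add (Finset.measurable_sum _ fun j _ => m₂ j)
    · exact Finset.measurable_sum _ fun j _ => m₁ j
    · exact lintegral_sq_sum_ne_top _ m₁ fun j => (hV₁ j).lintegral_sq_ne_top (by norm_num)
    · exact lintegral_sq_sum_ne_top _ m₂ fun j => (hV₂ j).lintegral_sq_ne_top (by norm_num)
  have hP : ∫⁻ t in Icc 0 T, P t ^ 2 ≠ ∞ := by
    refine lintegral_sq_add_ne_top (Finset.measurable_sum _ fun j _ => mw 2 j)
      (lintegral_sq_sum_ne_top _ (mw 2) fun j => (hw j).lintegral_sq_ne_top (by norm_num))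
      (hη.lintegral_sq_ne_top (by norm_num))
  have hD : ∫⁻ t in Icc 0 T, D t ≠ ∞ := by
    simp only [D]
    rw [lintegral_add_right _ (mη 1), lintegral_finsetSum _ fun j _ => mw 3 j]
    refine ENNReal.add_ne_top.2 ⟨ENNReal.sum_ne_top.2 fun j _ => ?_, ?_⟩
    · have := (hw j).integrable
      norm_num at this
      exact this
    · have := hη.integrable
      norm_num at this
      exact this
  obtain ⟨M, hM, hE⟩ : ∃ M : ℝ≥0∞, M ≠ ∞ ∧ ∀ᵐ t ∂(volume.restrict (Icc 0 T)), E t ≤ M := by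
    choose M hM hb using fun j => (hw j).bounded
    obtain ⟨M', hM', hb'⟩ := hη.bounded
    refine ⟨(∑ j, M j) + M', ENNReal.add_ne_top.2 ⟨ENNReal.sum_ne_top.2 fun j _ => hM j, hM'⟩, ?_⟩
    filter_upwards [ae_all_iff.2 hb, hb'] with t h1 h2
    exact add_le_add (Finset.sum_le_sum fun j _ => h1 j) h2
  -- Each of the four terms of `P` has square at most `E D` by interpolation, and `16 = 4²`.
  have hPED : ∀ t, P t ^ 2 ≤ 16 * (E t * D t) := by
    intro t
    have h1 : ∀ j, cEnergy 2 (fun ξ => V₁ j t ξ - V₂ j t ξ) ^ 2 ≤ E t * D t := fun j =>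
      (sq_energy_le (a := 1) (c := 3) (by norm_num) ((hw j).measurable_slice t).enorm).trans
        (mul_le_mul'
          ((Finset.single_le_sum (f := fun j => cEnergy 1 (fun ξ => V₁ j t ξ - V₂ j t ξ))
            (fun _ _ => zero_le) (Finset.mem_univ j)).trans le_self_add)
          ((Finset.single_le_sum (f := fun j => cEnergy 3 (fun ξ => V₁ j t ξ - V₂ j t ξ))
            (fun _ _ => zero_le) (Finset.mem_univ j)).trans le_self_add))
    have h2 : cEnergy 0 (fun ξ => Θ₁ t ξ - Θ₂ t ξ) ^ 2 ≤ E t * D t :=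
      (sq_energy_le (a := -1) (c := 1) (by norm_num) (hη.measurable_slice t).enorm).trans
        (mul_le_mul' le_add_self le_add_self)
    have h3 : P t = (cEnergy 2 (fun ξ => V₁ 0 t ξ - V₂ 0 t ξ) +
        cEnergy 2 (fun ξ => V₁ 1 t ξ - V₂ 1 t ξ)) + (cEnergy 2 (fun ξ => V₁ 2 t ξ - V₂ 2 t ξ) +
        cEnergy 0 (fun ξ => Θ₁ t ξ - Θ₂ t ξ)) := by
      simp only [P, Fin.sum_univ_three]
      ring
    rw [h3]
    calc _ ≤ _ := sq_add_le _ _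
      _ ≤ 2 * (2 * (E t * D t + E t * D t) + 2 * (E t * D t + E t * D t)) :=
        mul_le_mul_right (add_le_add
          ((sq_add_le _ _).trans (mul_le_mul_right (add_le_add (h1 0) (h1 1)) _))
          ((sq_add_le _ _).trans (mul_le_mul_right (add_le_add (h1 2) h2) _))) _
      _ = 16 * (E t * D t) := by ring
  obtain ⟨K, hK, hF⟩ := exists_forcing_le
  have hforce : ∀ᵐ t ∂(volume.restrict (Icc 0 T)),
      (∀ i, cEnergy (1 - 2) (fun ξ => velocityForcing (fun j => V₁ j t) (Θ₁ t) i ξ -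
        velocityForcing (fun j => V₂ j t) (Θ₂ t) i ξ) ≤ K * (P t * a t + E t)) ∧
      cEnergy (-1 - 2) (fun ξ => -advSymbol (fun j => V₁ j t) (Θ₁ t) ξ -
        -advSymbol (fun j => V₂ j t) (Θ₂ t) ξ) ≤ K * (P t * a t + E t) := by
    filter_upwards [ae_all_iff.2 fun j => (hV₁ j).memLp, ae_all_iff.2 fun j => (hV₂ j).memLp,
      hΘ₁.memLp, hΘ₂.memLp] with t l1 l2 l3 l4
    rw [show (1 : ℝ) - 2 = -1 by norm_num, show (-1 : ℝ) - 2 = -3 by norm_num]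
    refine hF _ _ _ _ (fun j => (hV₁ j).measurable_slice t) (fun j => (hV₂ j).measurable_slice t)
      (hΘ₁.measurable_slice t) (hΘ₂.measurable_slice t) l1 l2 l3 l4 (P t) (a t) (E t)
      (fun j => ?_) le_add_self (fun j => ?_) (fun j => ?_) le_add_self le_add_self
    · exact (Finset.single_le_sum (f := fun j => cEnergy 2 (fun ξ => V₁ j t ξ - V₂ j t ξ))
        (fun _ _ => zero_le) (Finset.mem_univ j)).trans le_self_add
    · exact (Finset.single_le_sum (f := fun j => cEnergy 2 (V₁ j t))
        (fun _ _ => zero_le) (Finset.mem_univ j)).trans (le_self_add.trans le_self_add)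
    · exact (Finset.single_le_sum (f := fun j => cEnergy 2 (V₂ j t))
        (fun _ _ => zero_le) (Finset.mem_univ j)).trans (le_add_self.trans le_self_add)
  have hfin : ∫⁻ t in Icc 0 T, K * (P t * a t + E t) ≠ ∞ := by
    rw [lintegral_const_mul' _ _ hK, lintegral_add_right _ mE]
    refine ENNReal.mul_ne_top hK (ENNReal.add_ne_top.2 ⟨?_, ?_⟩)
    · refine ne_top_of_le_ne_top ?_ (lintegral_mono fun t => mul_le_sq_add_sq (P t) (a t))
      rw [lintegral_add_left (mP.pow_const 2)]
      exact ENNReal.add_ne_top.2 ⟨hP, ha⟩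
    · refine ne_top_of_le_ne_top ?_ (lintegral_mono_ae hE)
      simp only [lintegral_const, MeasurableSet.univ, Measure.restrict_apply, univ_inter,
        Real.volume_Icc]
      finiteness
  have pV₁ : ∀ j, Measurable fun p : ℝ × R3 => V₁ j p.1 p.2 := fun j => (hV₁ j).measurable
  have pV₂ : ∀ j, Measurable fun p : ℝ × R3 => V₂ j p.1 p.2 := fun j => (hV₂ j).measurable
  have hvel := fun i => ae_cEnergy_sub_add_lintegral_le (s := 1) (hV₁ i).represents
    (hV₂ i).represents (represents_fourier_velocityForcing hV₁ hΘ₁ i)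
    (represents_fourier_velocityForcing hV₂ hΘ₂ i)
    (measurable_velocityForcing (V := fun t j => V₁ j t) pV₁ hΘ₁.measurable i)
    (measurable_velocityForcing (V := fun t j => V₂ j t) pV₂ hΘ₂.measurable i)
    (by norm_num) (by norm_num)
    (ne_top_of_le_ne_top hfin (lintegral_mono_ae (hforce.mono fun t ht => ht.1 i)))
    (hsol₁.velocity_eq i) (hsol₂.velocity_eq i)
  have htem := ae_cEnergy_sub_add_lintegral_le (s := -1) hΘ₁.represents
    hΘ₂.represents (represents_fourier_neg_advection hV₁ hΘ₁)
    (represents_fourier_neg_advection hV₂ hΘ₂)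
    (measurable_advSymbol (V := fun t j => V₁ j t) pV₁ hΘ₁.measurable).neg
    (measurable_advSymbol (V := fun t j => V₂ j t) pV₂ hΘ₂.measurable).neg
    (by norm_num) (by norm_num)
    (ne_top_of_le_ne_top hfin (lintegral_mono_ae (hforce.mono fun t ht => ht.2)))
    hsol₁.temperature_eq hsol₂.temperature_eq
  rw [show (-1 : ℝ) + 2 = 1 by norm_num] at htem
  -- The factor `8` collects three velocity components and the temperature, each contributing the
  -- `2` of the parabolic estimate.
  have hzero := ae_eq_zero_of_energy_inequality (E := E) (D := D) (P := P) (a := a) (K := 8 * K)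
    (by finiteness) hM mD ha hD hE (ae_of_all _ hPED) (by
      filter_upwards [ae_all_iff.2 hvel, htem, ae_restrict_mem measurableSet_Icc] with t h1 h2 ht
      have hsub : Icc 0 t ⊆ Icc 0 T := Icc_subset_Icc_right ht.2
      have hforce' := ae_restrict_of_ae_restrict_of_subset hsub hforce
      set X := ∫⁻ τ in Icc 0 t, K * (P τ * a τ + E τ) with hX
      have h3 : ∀ i, cEnergy 1 (fun ξ => V₁ i t ξ - V₂ i t ξ) +
          ∫⁻ τ in Icc 0 t, cEnergy 3 (fun ξ => V₁ i τ ξ - V₂ i τ ξ) ≤ 2 * X := by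
        intro i
        have h := h1 i
        rw [show (1 : ℝ) + 2 = 3 by norm_num] at h
        exact h.trans (mul_le_mul_right
          (lintegral_mono_ae (hforce'.mono fun τ hτ => hτ.1 i)) _)
      have h4 := h2.trans (mul_le_mul_right
        (lintegral_mono_ae (hforce'.mono fun τ hτ => hτ.2)) 2)
      have e : ∫⁻ τ in Icc 0 t, 8 * K * (P τ * a τ + E τ) = 8 * X := by
        rw [hX, ← lintegral_const_mul' _ _ (by simp)]
        simp only [mul_assoc]
      have eD : ∫⁻ τ in Icc 0 t, D τ =
          (∑ j, ∫⁻ τ in Icc 0 t, cEnergy 3 (fun ξ => V₁ j τ ξ - V₂ j τ ξ)) +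
          ∫⁻ τ in Icc 0 t, cEnergy 1 (fun ξ => Θ₁ τ ξ - Θ₂ τ ξ) := by
        simp only [D]
        rw [lintegral_add_right _ (mη 1), lintegral_finsetSum _ fun j _ => mw 3 j]
      rw [e, eD]
      simp only [E]
      rw [add_add_add_comm, ← Finset.sum_add_distrib]
      calc _ ≤ (∑ _j : Fin 3, 2 * X) + 2 * X :=
            add_le_add (Finset.sum_le_sum fun j _ => h3 j) h4
        _ = 8 * X := by
            rw [Finset.sum_const, Finset.card_univ, Fintype.card_fin, nsmul_eq_mul]
            push_cast
            ring)
  filter_upwards [hzero, ae_all_iff.2 fun j => (hV₁ j).represents,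
    ae_all_iff.2 fun j => (hV₂ j).represents, hΘ₁.represents, hΘ₂.represents] with t h0 r1 r2 r3 r4
  simp only [E, add_eq_zero, Finset.sum_eq_zero_iff, Finset.mem_univ, true_imp_iff] at h0
  exact ⟨funext fun j => eq_of_fourier_represents (r1 j) (r2 j)
      (ae_eq_of_cEnergy_sub_eq_zero ((hV₁ j).measurable_slice t) ((hV₂ j).measurable_slice t)
        (h0.1 j)),
    eq_of_fourier_represents r3 r4
      (ae_eq_of_cEnergy_sub_eq_zero (hΘ₁.measurable_slice t) (hΘ₂.measurable_slice t) h0.2)⟩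

end Boussinesq

end

theorem proposition1 (T₀ : ℝ) (hT₀ : 0 < T₀)
    (u₀ : Fin 3 → Boussinesq.Distr) (θ₀ : Boussinesq.Distr)
    (hu₀ : ∀ i, Boussinesq.sobolevNorm (1 / 2) (u₀ i) < ∞)
    (hdiv : Boussinesq.divergence u₀ = 0)
    (hθ₀ : Boussinesq.homSobolevNorm (-1 / 2) θ₀ < ∞)
    (u₁ u₂ : ℝ → Fin 3 → Boussinesq.Distr) (θ₁ θ₂ : ℝ → Boussinesq.Distr)
    (hsol₁ : Boussinesq.IsMildSolution T₀ u₀ θ₀ u₁ θ₁)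
    (hsol₂ : Boussinesq.IsMildSolution T₀ u₀ θ₀ u₂ θ₂)
    (hu₁ : Boussinesq.VelocityClass T₀ u₁) (hu₂ : Boussinesq.VelocityClass T₀ u₂)
    (hθ₁ : Boussinesq.TemperatureClass T₀ θ₁) (hθ₂ : Boussinesq.TemperatureClass T₀ θ₂) :
    ∀ᵐ t ∂(volume.restrict (Icc 0 T₀)), u₁ t = u₂ t ∧ θ₁ t = θ₂ t := by
  choose V₁ hV₁ using fun i => Boussinesq.exists_isFourierOf_velocity (hu₁ i).1 (hu₁ i).2
  choose V₂ hV₂ using fun i => Boussinesq.exists_isFourierOf_velocity (hu₂ i).1 (hu₂ i).2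
  obtain ⟨Θ₁, hΘ₁⟩ := Boussinesq.exists_isFourierOf_temperature hθ₁.1 hθ₁.2.1
  obtain ⟨Θ₂, hΘ₂⟩ := Boussinesq.exists_isFourierOf_temperature hθ₂.1 hθ₂.2.1
  exact Boussinesq.ae_eq_of_isFourierOf hsol₁ hsol₂ hV₁ hV₂ hΘ₁ hΘ₂
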